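/- Let $\alpha>0$ and let $w$ be a weight on $\mathbb C$, i.e. a non-negative locally integrable function that does not vanish almost everywhere with respect to Lebesgue measure $dA$. Suppose that $w\in A^{\mathrm{res}}_\infty:=\bigcup_{1\le p<\infty}A^{\mathrm{res}}_p$. Here, for $1<p<\infty$ and $1/p+1/p'=1$, $w\in A^{\mathrm{res}}_p$ means that for some $r>0$ $$\sup_{Q:\ell(Q)=r}\Big(\frac1{A(Q)}\int_Q w\,dA\Big)\Big(\frac1{A(Q)}\int_Q w^{-p'/p}\,dA\Big)^{p/p'}<\infty,$$ and $w\in A^{\mathrm{res}}_1$ means that for some $r>0$ $$\sup_{Q:\ell(Q)=r}\Big(\frac1{A(Q)}\int_Q w\,dA\Big)\,\|w^{-1}\|_{L^\infty(Q)}<\infty,$$ where $Q$ runs over the squares in $\mathbb C$ with sides parallel to the coordinate axes and side length $\ell(Q)=r$ (negative powers of $0$ are $\infty$, and $0\cdot\infty=0$). Let $F^2_{\alpha,w}$ be the space of entire functions $f$ with $\int_{\mathbb C}|f(z)|^2e^{-\alpha|z|^2}w(z)\,dA(z)<\infty$, with the inner product of $L^2(e^{-\alpha|z|^2}w\,dA)$.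 Let $a,b\in\mathbb C$, $g(z)=az+b$, and $J_gf(z)=\int_0^z f(\xi)g'(\xi)\,d\xi$. Then $J_g$ is a bounded operator on $F^2_{\alpha,w}$ that belongs to the Schatten class $S_p(F^2_{\alpha,w})$ for every $p>2$, and $J_g$ is Hilbert–Schmidt (i.e. belongs to $S_2(F^2_{\alpha,w})$) if and only if $a=0$. Here, for $p>0$, a bounded operator $T$ on $H=F^2_{\alpha,w}$ belongs to $S_p(H)$ if $Tx=\sum_{n} s_n\langle x,e_n\rangle\sigma_n$ for all $x\in H$, with (finite or infinite) orthonormal sequences $(e_n)$, $(\sigma_n)$ in $H$ and non-increasing numbers $s_n\ge0$ (tending to $0$ if the sequence is infinite) such that $\sum_n s_n^p<\infty$. -/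

import Mathlib

open MeasureTheory Filter Topology
open scoped ENNReal

noncomputable section

namespace WeightedFock

/-- A weight on the complex plane: a non-negative locally integrable function that does not
vanish almost everywhere. -/
structure IsWeight (w : ℂ → ℝ) : Prop where
  nonneg : ∀ z, 0 ≤ w z
  locallyIntegrable : LocallyIntegrable w volume
  not_ae_zero : ¬ (w =ᵐ[volume] 0)

/-- The closed square with sides parallel to the coordinate axes, lower left corner `c` and
side length `r`. -/
def square (c : ℂ) (r : ℝ) : Set ℂ :=
  Set.Icc c.re (c.re + r) ×ℂ Set.Icc c.im (c.im + r)

/-- The average `A(Q)⁻¹ ∫_Q f dA`, with values in `[0, ∞]`. -/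
def meanValue (f : ℂ → ℝ≥0∞) (Q : Set ℂ) : ℝ≥0∞ :=
  (∫⁻ z in Q, f z) / volume Q

/-- The restricted class `A_p` for `1 < p < ∞`: the Muckenhoupt product is bounded uniformly over
all squares of one fixed side length `r`. It is computed in `[0, ∞]`, where a negative power
of `0` is `∞`. -/
def IsRestrictedAp (p : ℝ) (w : ℂ → ℝ) : Prop :=
  ∃ r : ℝ, 0 < r ∧
    (⨆ c : ℂ, meanValue (fun z => ENNReal.ofReal (w z)) (square c r) *
      meanValue (fun z => ENNReal.ofReal (w z) ^ (-(p.conjExponent / p))) (square c r) ^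
        (p / p.conjExponent)) < ∞

/-- The restricted class `A_1`: as above, with the essential supremum of `1 / w` on the square
as second factor. -/
def IsRestrictedA1 (w : ℂ → ℝ) : Prop :=
  ∃ r : ℝ, 0 < r ∧
    (⨆ c : ℂ, meanValue (fun z => ENNReal.ofReal (w z)) (square c r) *
      essSup (fun z => (ENNReal.ofReal (w z))⁻¹) (volume.restrict (square c r))) < ∞

/-- The restricted class `A_∞`: the union of the restricted classes `A_p`, `1 ≤ p < ∞`. -/
def IsRestrictedAInfty (w : ℂ → ℝ) : Prop :=
  IsRestrictedA1 w ∨ ∃ p : ℝ, 1 < p ∧ IsRestrictedAp p w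

/-- The measure `exp (-α |z|²) w(z) dA(z)` on the complex plane. -/
def fockMeasure (α : ℝ) (w : ℂ → ℝ) : Measure ℂ :=
  volume.withDensity fun z => ENNReal.ofReal (Real.exp (-α * ‖z‖ ^ 2) * w z)

/-- The weighted Fock space `F²_{α,w}`: the subspace of (classes of) entire functions in
`L²(exp (-α |z|²) w dA)`, with the inherited norm and inner product. -/
def fockSpace (α : ℝ) (w : ℂ → ℝ) : Submodule ℂ (Lp ℂ 2 (fockMeasure α w)) where
  carrier := {f | ∃ F : ℂ → ℂ, Differentiable ℂ F ∧ f =ᵐ[fockMeasure α w] F}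
  zero_mem' := ⟨0, differentiable_const 0, Lp.coeFn_zero ℂ 2 _⟩
  add_mem' := by
    rintro f g ⟨F, hF, hfF⟩ ⟨G, hG, hgG⟩
    exact ⟨F + G, hF.add hG, (Lp.coeFn_add f g).trans (hfF.add hgG)⟩
  smul_mem' := by
    rintro c f ⟨F, hF, hfF⟩
    exact ⟨c • F, hF.const_smul c, (Lp.coeFn_smul c f).trans (hfF.const_smul c)⟩

/-- The Volterra operator `J_g f (z) = ∫₀ᶻ f(ξ) g'(ξ) dξ`, the integral being taken along the
segment `ξ = t z`, `0 ≤ t ≤ 1`. -/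
def volterra (g f : ℂ → ℂ) (z : ℂ) : ℂ :=
  ∫ t in (0 : ℝ)..1, f (t * z) * deriv g (t * z) * z

/-- The bounded operator `J` on `F²_{α,w}` is the Volterra operator `J_g`: it sends the class of an
entire function `F` to the class of `J_g F`. -/
def IsVolterraOperator {α : ℝ} {w : ℂ → ℝ} (g : ℂ → ℂ)
    (J : fockSpace α w →L[ℂ] fockSpace α w) : Prop :=
  ∀ (f : fockSpace α w) (F : ℂ → ℂ), Differentiable ℂ F →
    (f : Lp ℂ 2 (fockMeasure α w)) =ᵐ[fockMeasure α w] F →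
    (J f : Lp ℂ 2 (fockMeasure α w)) =ᵐ[fockMeasure α w] volterra g F

/-- The Schatten class `S_p(H)`: `T` has a canonical decomposition
`T x = ∑ s_n ⟨x, e_n⟩ σ_n` with singular values `s_n` decreasing to `0` and `∑ s_n ^ p < ∞`.
The vectors `e_n`, and likewise `σ_n`, with `s_n ≠ 0` are orthonormal, which allows
finite rank. -/
def MemSchatten {H : Type*} [NormedAddCommGroup H] [InnerProductSpace ℂ H] (p : ℝ)
    (T : H →L[ℂ] H) : Prop :=
  ∃ (s : ℕ → ℝ) (e σ : ℕ → H),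
    Antitone s ∧ (∀ n, 0 ≤ s n) ∧ Tendsto s atTop (𝓝 0) ∧
    Orthonormal ℂ (fun n : {n : ℕ // s n ≠ 0} => e n) ∧
    Orthonormal ℂ (fun n : {n : ℕ // s n ≠ 0} => σ n) ∧
    (∀ x : H, HasSum (fun n => ((s n : ℂ) * inner ℂ (e n) x) • σ n) (T x)) ∧
    Summable fun n => s n ^ p

/-- Hilbert–Schmidt operators: the Schatten class `S_2(H)`. -/
def IsHilbertSchmidt {H : Type*} [NormedAddCommGroup H] [InnerProductSpace ℂ H]
    (T : H →L[ℂ] H) : Prop :=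
  MemSchatten 2 T

end WeightedFock

end

/-! Write m = w dA, and W(z) for the m-mass of the disc D(z, δ). The restricted A_∞ condition and
the non-vanishing of w enter only through `RestrictedDoubling`: at one scale δ, every D(z, δ) has
finite positive mass, and a subdisc of radius ρ carries at least a fixed multiple of (ρ/δ)^N of it.
Three facts follow. W varies at most exponentially (`exists_growth`). Entire F satisfy |F(z)|²
e^{-α|z|²} W(z) ≲ ∫_{D(z,δ)} |F|² e^{-α|ζ|²} dm (`exists_gaussSq_mul_measure_le`). And ∫ φ/W dm is
comparable to ∫ φ dA when φ varies slowly at scale δ (`lintegral_div_le`, `lintegral_le`).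

Upper bound. Integrating along the segment from 0 to z against the growth of e^{α|z|²/2} gains a
factor 1/(1+|z|); the exponential variation of W is absorbed by the Gaussian. This gives ‖J f‖² ≲ ∫
(1+|z|)^{-2} |f|² e^{-α|z|²} dm (`exists_lintegral_gaussSq_volterra_le`). For an orthonormal family
(e_i), Jensen's inequality with exponent p/2 and the Bessel bound ∑ |e_i(z)|² e^{-α|z|²} ≲ 1/W(z)
yield ∑ ‖J e_i‖^p ≲ ∫ (1+|z|)^{-p}/W dm, which is comparable to ∫ (1+|z|)^{-p} dA and hence finite
for p > 2. A uniform bound over finite orthonormal families gives membership in S_p by the spectral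
theorem for T*T (`memSchatten_of_sum_norm_rpow_le`).

Lower bound. If J = ∑ s_n ⟨·, e_n⟩ σ_n, then Cauchy–Schwarz and Bessel give |J f(z)|² ≤ ‖f‖² ∑ s_n²
|σ_n(z)|². For f(ζ) = e^{α z̄ ζ} one has ‖f‖² ≲ e^{α|z|²} W(z), while |J f(z)| is of order |a|
e^{α|z|²}/|z| for |z| ≥ 1. Hence |a|² |z|^{-2}/W(z) ≲ ∑ s_n² |σ_n(z)|² e^{-α|z|²}. Integrating dm,
the right side becomes ∑ s_n² and the left side diverges like ∫_{|z| ≥ 1} |z|^{-2} dA unless a = 0.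
-/

namespace WeightedFock

/-! ### From the restricted A_∞ condition to doubling at one scale -/

/-- A measure on `ℂ` which is doubling at the fixed scale `δ`: the mass of a disc of radius `δ`
is controlled by the mass of the smaller discs it contains. -/
structure RestrictedDoubling (m : Measure ℂ) (δ : ℝ) (N : ℕ) (C : ℝ≥0∞) : Prop where
  radius_pos : 0 < δ
  const_ne_top : C ≠ ∞
  ne_zero : ∀ z, m (Metric.closedBall z δ) ≠ 0
  ne_top : ∀ z, m (Metric.closedBall z δ) ≠ ∞
  le : ∀ z c ρ, 0 < ρ → ρ ≤ δ → Metric.closedBall c ρ ⊆ Metric.closedBall z δ →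
    ENNReal.ofReal ((ρ / δ) ^ N) * m (Metric.closedBall z δ) ≤ C * m (Metric.closedBall c ρ)

/-- With B the essential supremum of 1/u on Q, 1 ≤ B u almost everywhere on Q, so |E| ≤ B ∫_E u.
This is the exponent p = 1 of the next lemma. -/
lemma volume_rpow_mul_lintegral_le_of_one {u : ℂ → ℝ≥0∞} (hut : ∀ z, u z ≠ ∞)
    {Q E : Set ℂ} {K : ℝ≥0∞}
    (hQ0 : volume Q ≠ 0) (hQt : volume Q ≠ ∞) (hE : E ⊆ Q) (hKt : K ≠ ∞)
    (hK : meanValue u Q * essSup (fun z => (u z)⁻¹) (volume.restrict Q) ≤ K) :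
    volume E * ∫⁻ z in Q, u z ≤ K * volume Q * ∫⁻ z in E, u z := by
  set B := essSup (fun z => (u z)⁻¹) (volume.restrict Q) with hB
  rcases eq_or_ne (∫⁻ z in Q, u z) 0 with h0 | h0
  · simp [h0]
  have hBt : B ≠ ∞ := by
    rintro hBt
    rw [hBt, ENNReal.mul_top] at hK
    · exact hKt (top_le_iff.1 hK)
    · simp [meanValue, ENNReal.div_eq_zero_iff, h0, hQt]
  have hae : ∀ᵐ z ∂volume.restrict E, 1 ≤ B * u z := by
    refine ae_restrict_of_ae_restrict_of_subset hE ?_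
    filter_upwards [ENNReal.ae_le_essSup (μ := volume.restrict Q) (fun z => (u z)⁻¹)] with z hz
    have hz0 : u z ≠ 0 := by
      intro h
      rw [h, ENNReal.inv_zero] at hz
      exact hBt (top_le_iff.1 hz)
    calc (1 : ℝ≥0∞) = (u z)⁻¹ * u z := (ENNReal.inv_mul_cancel hz0 (hut z)).symm
      _ ≤ B * u z := by gcongr
  have hvol : volume E ≤ B * ∫⁻ z in E, u z := by
    rw [← lintegral_const_mul' _ _ hBt]
    calc volume E = ∫⁻ _ in E, 1 := by simp
      _ ≤ _ := lintegral_mono_ae hae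
  calc volume E * ∫⁻ z in Q, u z
      ≤ (B * ∫⁻ z in E, u z) * (meanValue u Q * volume Q) := by
        gcongr
        rw [meanValue, ENNReal.div_mul_cancel hQ0 hQt]
    _ = (meanValue u Q * B) * volume Q * ∫⁻ z in E, u z := by ring
    _ ≤ _ := by gcongr

/-- Hölder's inequality for 1 = u^{1/p} u^{-1/p} on E, with the second factor enlarged to Q, where
the A_p condition controls it. -/
lemma volume_rpow_mul_lintegral_le {u : ℂ → ℝ≥0∞} (hu : AEMeasurable u)
    (hut : ∀ z, u z ≠ ∞) {Q E : Set ℂ} {K : ℝ≥0∞} {p : ℝ} (hp : 1 < p)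
    (hQ0 : volume Q ≠ 0) (hQt : volume Q ≠ ∞) (hE : E ⊆ Q) (hKt : K ≠ ∞)
    (hK : meanValue u Q * meanValue (fun z => u z ^ (-(p.conjExponent / p))) Q ^
      (p / p.conjExponent) ≤ K) :
    volume E ^ p * ∫⁻ z in Q, u z ≤ K * volume Q ^ p * ∫⁻ z in E, u z := by
  set q := p.conjExponent with hq
  have hpq : p.HolderConjugate q := .conjExponent hp
  have hp0 : 0 < p := hpq.pos
  have hq0 : 0 < q := hpq.symm.pos
  have hpq' : 1 + p / q = p := by
    have := hpq.inv_add_inv_eq_one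
    field_simp at this ⊢
    linarith
  set σ := ∫⁻ z in Q, u z ^ (-(q / p)) with hσ
  rcases eq_or_ne (∫⁻ z in Q, u z) 0 with h0 | h0
  · simp [h0]
  -- If σ were infinite, the A_p product would be infinite, because the mean of u is nonzero.
  -- Finiteness of σ forces u > 0 almost everywhere on Q, which makes the factorisation of 1
  -- legitimate.
  have hσt : σ ≠ ∞ := by
    intro h
    have : meanValue (fun z => u z ^ (-(q / p))) Q = ∞ := by
      rw [meanValue, ← hσ, h, ENNReal.top_div_of_ne_top hQt]
    rw [this, ENNReal.top_rpow_of_pos (by positivity), ENNReal.mul_top] at hK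
    · exact hKt (top_le_iff.1 hK)
    · simp [meanValue, ENNReal.div_eq_zero_iff, h0, hQt]
  have hae : ∀ᵐ z ∂volume.restrict E, u z ^ (1 / p) * u z ^ (-(1 / p)) = 1 := by
    refine ae_restrict_of_ae_restrict_of_subset hE ?_
    filter_upwards [ae_lt_top' ((hu.pow_const _).restrict) hσt] with z hz
    have hz0 : u z ≠ 0 := by
      intro h
      rw [h, ENNReal.zero_rpow_of_neg (by simp; positivity)] at hz
      exact lt_irrefl _ hz
    rw [ENNReal.rpow_neg, ENNReal.mul_inv_cancel]
    · simp [hz0, hut z]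
    · exact ENNReal.rpow_ne_top_of_nonneg (by positivity) (hut z)
  have hvol : volume E ≤ (∫⁻ z in E, u z) ^ (1 / p) * σ ^ (1 / q) := by
    calc volume E = ∫⁻ _ in E, 1 := by simp
      _ = ∫⁻ z in E, ((fun z => u z ^ (1 / p)) * (fun z => u z ^ (-(1 / p)))) z :=
        lintegral_congr_ae (hae.mono fun z hz => by simpa using hz.symm)
      _ ≤ _ := ENNReal.lintegral_mul_le_Lp_mul_Lq _ hpq (hu.pow_const _).restrict
        (hu.pow_const _).restrict
      _ = (∫⁻ z in E, u z) ^ (1 / p) * (∫⁻ z in E, u z ^ (-(q / p))) ^ (1 / q) := by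
        congr 2
        · refine lintegral_congr fun z => ?_
          rw [← ENNReal.rpow_mul, one_div_mul_cancel hp0.ne', ENNReal.rpow_one]
        · refine lintegral_congr fun z => ?_
          rw [← ENNReal.rpow_mul]
          congr 1
          ring
      _ ≤ _ := by
        gcongr
        exact lintegral_mono_set hE
  have hvol' : volume E ^ p ≤ (∫⁻ z in E, u z) * σ ^ (p / q) := by
    calc volume E ^ p ≤ ((∫⁻ z in E, u z) ^ (1 / p) * σ ^ (1 / q)) ^ p := by gcongr
      _ = _ := by
        rw [ENNReal.mul_rpow_of_nonneg _ _ hp0.le, ← ENNReal.rpow_mul, ← ENNReal.rpow_mul,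
          one_div_mul_cancel hp0.ne', ENNReal.rpow_one]
        congr 2
        ring
  have hKQ : (∫⁻ z in Q, u z) * σ ^ (p / q) ≤ K * volume Q ^ p := by
    have h1 : (∫⁻ z in Q, u z) = meanValue u Q * volume Q := by
      rw [meanValue, ENNReal.div_mul_cancel hQ0 hQt]
    have h2 : σ = meanValue (fun z => u z ^ (-(q / p))) Q * volume Q := by
      rw [meanValue, ENNReal.div_mul_cancel hQ0 hQt]
    calc (∫⁻ z in Q, u z) * σ ^ (p / q)
        = meanValue u Q * meanValue (fun z => u z ^ (-(q / p))) Q ^ (p / q) *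
          (volume Q ^ (1 : ℝ) * volume Q ^ (p / q)) := by
          rw [h1, h2, ENNReal.mul_rpow_of_nonneg _ _ (by positivity), ENNReal.rpow_one]
          ring
      _ ≤ K * volume Q ^ p := by
          rw [← ENNReal.rpow_add _ _ hQ0 hQt, hpq']
          gcongr
  calc volume E ^ p * ∫⁻ z in Q, u z
      ≤ ((∫⁻ z in E, u z) * σ ^ (p / q)) * ∫⁻ z in Q, u z := by gcongr
    _ = ((∫⁻ z in Q, u z) * σ ^ (p / q)) * ∫⁻ z in E, u z := by ring
    _ ≤ _ := by gcongr

lemma volume_square (c : ℂ) (r : ℝ) : volume (square c r) = ENNReal.ofReal r ^ 2 := by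
  have h := Complex.volume_preserving_equiv_real_prod.measure_preimage_equiv
    (Set.Icc c.re (c.re + r) ×ˢ Set.Icc c.im (c.im + r))
  rw [Measure.volume_eq_prod, Measure.prod_prod, Real.volume_Icc, Real.volume_Icc] at h
  have h2 : square c r = Complex.measurableEquivRealProd ⁻¹'
      (Set.Icc c.re (c.re + r) ×ˢ Set.Icc c.im (c.im + r)) := by
    ext z
    simp [square, Complex.mem_reProdIm]
    tauto
  rw [h2, h]
  simp [sq]

/-- The restricted class `A_∞` in terms of the relative size of subsets of squares. -/
lemma IsRestrictedAInfty.exists_volume_rpow_mul_le {w : ℂ → ℝ} (hw : IsWeight w)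
    (h : IsRestrictedAInfty w) :
    ∃ r : ℝ, 0 < r ∧ ∃ p : ℝ, 0 < p ∧ ∃ K : ℝ≥0∞, K ≠ ∞ ∧ ∀ (c : ℂ) (E : Set ℂ), E ⊆ square c r →
      volume E ^ p * ∫⁻ z in square c r, ENNReal.ofReal (w z) ≤
        K * ∫⁻ z in E, ENNReal.ofReal (w z) := by
  have hu : AEMeasurable (fun z => ENNReal.ofReal (w z)) :=
    hw.locallyIntegrable.aestronglyMeasurable.aemeasurable.ennreal_ofReal
  rcases h with ⟨r, hr, h⟩ | ⟨p, hp, r, hr, h⟩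
  · obtain ⟨S, hS, hle⟩ : ∃ S : ℝ≥0∞, S ≠ ∞ ∧
        ∀ c : ℂ, meanValue (fun z => ENNReal.ofReal (w z)) (square c r) *
          essSup (fun z => (ENNReal.ofReal (w z))⁻¹) (volume.restrict (square c r)) ≤ S :=
      ⟨_, h.ne, fun c => le_iSup_of_le c le_rfl⟩
    refine ⟨r, hr, 1, one_pos, S * ENNReal.ofReal r ^ 2, by finiteness, fun c E hE => ?_⟩
    have := volume_rpow_mul_lintegral_le_of_one (u := fun z => ENNReal.ofReal (w z))
      (fun _ => ENNReal.ofReal_ne_top) (by simp [volume_square, hr]) (by simp [volume_square]) hE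
      hS (hle c)
    rwa [volume_square, ← ENNReal.rpow_one (volume E)] at this
  · obtain ⟨S, hS, hle⟩ : ∃ S : ℝ≥0∞, S ≠ ∞ ∧
        ∀ c : ℂ, meanValue (fun z => ENNReal.ofReal (w z)) (square c r) *
          meanValue (fun z => ENNReal.ofReal (w z) ^ (-(p.conjExponent / p))) (square c r) ^
            (p / p.conjExponent) ≤ S :=
      ⟨_, h.ne, fun c => le_iSup_of_le c le_rfl⟩
    refine ⟨r, hr, p, by linarith, S * (ENNReal.ofReal r ^ 2) ^ p, ?_, fun c E hE => ?_⟩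
    · exact ENNReal.mul_ne_top hS (ENNReal.rpow_ne_top_of_nonneg (by linarith) (by simp))
    · have := volume_rpow_mul_lintegral_le (u := fun z => ENNReal.ofReal (w z)) hu
        (fun _ => ENNReal.ofReal_ne_top) hp
        (by simp [volume_square, hr]) (by simp [volume_square]) hE
        hS (hle c)
      rwa [volume_square] at this

lemma closedBall_subset_square (z : ℂ) (δ : ℝ) :
    Metric.closedBall z δ ⊆ square (z - δ * (1 + Complex.I)) (2 * δ) := by
  intro x hx
  rw [Metric.mem_closedBall, dist_eq_norm] at hx
  have h1 := (Complex.abs_re_le_norm (x - z)).trans hx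
  have h2 := (Complex.abs_im_le_norm (x - z)).trans hx
  rw [abs_le, Complex.sub_re] at h1
  rw [abs_le, Complex.sub_im] at h2
  simp only [square, Complex.mem_reProdIm, Set.mem_Icc, Complex.sub_re, Complex.sub_im,
    Complex.mul_re, Complex.mul_im, Complex.add_re, Complex.add_im, Complex.one_re,
    Complex.one_im, Complex.I_re, Complex.I_im, Complex.ofReal_re, Complex.ofReal_im]
  refine ⟨⟨?_, ?_⟩, ?_, ?_⟩ <;> linarith

/-- Discs of a fixed radius have comparable mass, if the weak doubling inequality holds. -/
lemma measure_closedBall_le_pow {m : Measure ℂ} {δ : ℝ} (hδ : 0 < δ) {N : ℕ} {C : ℝ≥0∞}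
    (h : ∀ z c ρ, 0 < ρ → ρ ≤ δ → Metric.closedBall c ρ ⊆ Metric.closedBall z δ →
      ENNReal.ofReal ((ρ / δ) ^ N) * m (Metric.closedBall z δ) ≤ C * m (Metric.closedBall c ρ))
    (n : ℕ) {z z' : ℂ} (hz : dist z z' ≤ n * δ) :
    m (Metric.closedBall z' δ) ≤ (2 ^ N * C) ^ n * m (Metric.closedBall z δ) := by
  induction n generalizing z' with
  | zero =>
    have : z = z' := by simpa using hz
    simp [this]
  | succ n ih =>
    -- One link of the chain: y is within δ of z', and the disc of radius δ/2 about the midpoint x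
    -- lies in both D(z', δ) and D(y, δ). Each link costs a factor 2^N C.
    obtain ⟨y, hy, hyz⟩ := exists_dist_le_le (by positivity : 0 ≤ n * δ) hδ.le
      (show dist z z' ≤ δ + n * δ by push_cast at hz; linarith)
    obtain ⟨x, hx, hxz⟩ := exists_dist_le_le (by positivity : 0 ≤ δ / 2)
      (by positivity : 0 ≤ δ / 2) (show dist y z' ≤ δ / 2 + δ / 2 by linarith)
    have h1 := h z' x (δ / 2) (by linarith) (by linarith)
      (Metric.closedBall_subset_closedBall' (by linarith))
    rw [show δ / 2 / δ = 2⁻¹ by field_simp, ENNReal.ofReal_pow (by norm_num),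
      ENNReal.ofReal_inv_of_pos two_pos, ENNReal.inv_pow.symm, ENNReal.inv_mul_le_iff
      (by simp) (by finiteness)] at h1
    calc m (Metric.closedBall z' δ)
        ≤ 2 ^ N * (C * m (Metric.closedBall x (δ / 2))) := by simpa using h1
      _ ≤ 2 ^ N * (C * m (Metric.closedBall y δ)) := by
        gcongr
        exact Metric.closedBall_subset_closedBall' (by rw [dist_comm]; linarith)
      _ ≤ 2 ^ N * (C * ((2 ^ N * C) ^ n * m (Metric.closedBall z δ))) := by
        gcongr
        exact ih hy
      _ = _ := by ring

/-- Chains of discs carry nullity from one disc to all, and countably many discs cover the plane.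
Consequently a weight has positive mass on every disc of radius δ. -/
lemma measure_closedBall_eq_zero_of_doubling {m : Measure ℂ} {δ : ℝ} (hδ : 0 < δ) {N : ℕ}
    {C : ℝ≥0∞}
    (h : ∀ z c ρ, 0 < ρ → ρ ≤ δ → Metric.closedBall c ρ ⊆ Metric.closedBall z δ →
      ENNReal.ofReal ((ρ / δ) ^ N) * m (Metric.closedBall z δ) ≤ C * m (Metric.closedBall c ρ))
    {z₀ : ℂ} (h0 : m (Metric.closedBall z₀ δ) = 0) : m = 0 := by
  have hall : ∀ z, m (Metric.closedBall z δ) = 0 := by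
    intro z
    obtain ⟨n, hn⟩ := exists_nat_ge (dist z₀ z / δ)
    have := measure_closedBall_le_pow hδ h n ((div_le_iff₀ hδ).1 hn)
    simpa [h0] using this
  rw [← Measure.measure_univ_eq_zero]
  have : (Set.univ : Set ℂ) = ⋃ n : ℕ, Metric.closedBall (TopologicalSpace.denseSeq ℂ n) δ := by
    symm
    rw [Set.eq_univ_iff_forall]
    intro x
    obtain ⟨n, hn⟩ := (TopologicalSpace.denseRange_denseSeq ℂ).exists_dist_lt x hδ
    exact Set.mem_iUnion.2 ⟨n, hn.le⟩
  rw [this]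
  exact measure_iUnion_null fun n => hall _

/-- A weight in the restricted class `A_∞` is doubling at a fixed scale. -/
theorem IsRestrictedAInfty.exists_restrictedDoubling {w : ℂ → ℝ} (hw : IsWeight w)
    (h : IsRestrictedAInfty w) :
    ∃ (δ : ℝ) (N : ℕ) (C : ℝ≥0∞),
      RestrictedDoubling (volume.withDensity fun z => ENNReal.ofReal (w z)) δ N C := by
  obtain ⟨r, hr, p, hp, K, hK, hE⟩ := h.exists_volume_rpow_mul_le hw
  set m := volume.withDensity fun z => ENNReal.ofReal (w z) with hm
  have hu : AEMeasurable (fun z => ENNReal.ofReal (w z)) :=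
    hw.locallyIntegrable.aestronglyMeasurable.aemeasurable.ennreal_ofReal
  set δ := r / 2 with hδr
  have hδ : 0 < δ := by positivity
  -- The p-th power of the area ratio of two discs is (ρ/δ)^(2p). As ρ ≤ δ, it may be weakened to an
  -- integer power N ≥ 2p.
  obtain ⟨N, hN⟩ := exists_nat_ge (2 * p)
  have hC0 : ENNReal.ofReal (δ ^ 2 * Real.pi) ^ p ≠ 0 := by
    rw [ENNReal.ofReal_rpow_of_pos (by positivity)]
    simp; positivity
  have hCt : ENNReal.ofReal (δ ^ 2 * Real.pi) ^ p ≠ ∞ :=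
    ENNReal.rpow_ne_top_of_nonneg hp.le ENNReal.ofReal_ne_top
  have hle : ∀ z c ρ, 0 < ρ → ρ ≤ δ → Metric.closedBall c ρ ⊆ Metric.closedBall z δ →
      ENNReal.ofReal ((ρ / δ) ^ N) * m (Metric.closedBall z δ) ≤
        (K / ENNReal.ofReal (δ ^ 2 * Real.pi) ^ p) * m (Metric.closedBall c ρ) := by
    intro z c ρ hρ hρδ hsub
    have hsq : Metric.closedBall z δ ⊆ square (z - δ * (1 + Complex.I)) r := by
      have := closedBall_subset_square z δ
      rwa [show 2 * δ = r by rw [hδr]; ring] at this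
    have h1 := hE _ _ (hsub.trans hsq)
    rw [withDensity_apply _ measurableSet_closedBall, withDensity_apply _ measurableSet_closedBall]
    have hvol : volume (Metric.closedBall c ρ) ^ p = ENNReal.ofReal ((ρ / δ) ^ (2 * p)) *
        ENNReal.ofReal (δ ^ 2 * Real.pi) ^ p := by
      rw [Complex.volume_closedBall, ENNReal.ofReal_rpow_of_pos (by positivity),
        ← ENNReal.ofReal_mul (by positivity), Real.rpow_mul (by positivity),
        ← Real.mul_rpow (by positivity) (by positivity), ← ENNReal.ofReal_rpow_of_pos
        (by positivity)]
      congr 1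
      rw [← ENNReal.ofReal_pow hρ.le]
      have : (NNReal.pi : ℝ≥0∞) = ENNReal.ofReal Real.pi := by
        rw [← NNReal.coe_real_pi, ENNReal.ofReal_coe_nnreal]
      rw [this, ← ENNReal.ofReal_mul (by positivity)]
      congr 1
      rw [show (2 : ℝ) = ((2 : ℕ) : ℝ) by norm_num, Real.rpow_natCast]
      field_simp
    rw [ENNReal.mul_div_right_comm.symm, ENNReal.le_div_iff_mul_le (.inl hC0) (.inl hCt)]
    calc ENNReal.ofReal ((ρ / δ) ^ N) * (∫⁻ a in Metric.closedBall z δ, ENNReal.ofReal (w a)) *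
          ENNReal.ofReal (δ ^ 2 * Real.pi) ^ p
        = ENNReal.ofReal ((ρ / δ) ^ N) * ENNReal.ofReal (δ ^ 2 * Real.pi) ^ p *
          ∫⁻ a in Metric.closedBall z δ, ENNReal.ofReal (w a) := by ring
      _ ≤ ENNReal.ofReal ((ρ / δ) ^ (2 * p)) * ENNReal.ofReal (δ ^ 2 * Real.pi) ^ p *
          ∫⁻ a in square (z - δ * (1 + Complex.I)) r, ENNReal.ofReal (w a) := by
        gcongr ENNReal.ofReal ?_ * _ * ?_
        · rw [← Real.rpow_natCast]
          exact Real.rpow_le_rpow_of_exponent_ge (by positivity) ((div_le_one hδ).2 hρδ) hN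
        · exact lintegral_mono_set hsq
      _ ≤ _ := by rwa [← hvol]
  refine ⟨δ, N, _, hδ, ENNReal.div_ne_top hK hC0, fun z hz => ?_, fun z => ?_, hle⟩
  · have := measure_closedBall_eq_zero_of_doubling hδ hle hz
    rw [hm, withDensity_eq_zero_iff hu] at this
    refine hw.not_ae_zero (this.mono fun z hz => ?_)
    have : w z ≤ 0 := by simpa using hz
    exact le_antisymm this (hw.nonneg z)
  · rw [withDensity_apply _ measurableSet_closedBall]
    have := hw.locallyIntegrable.integrableOn_isCompact (isCompact_closedBall z δ)
    exact this.lintegral_lt_top.ne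

/-! ### Growth of the disc masses, and comparison of dm/W with dA -/

section

variable {m : Measure ℂ} {δ : ℝ} {N : ℕ} {C : ℝ≥0∞}

lemma RestrictedDoubling.measure_le_of_dist_le (h : RestrictedDoubling m δ N C) {z z' : ℂ}
    (hz : dist z z' ≤ δ) :
    m (Metric.closedBall z' δ) ≤ 2 ^ N * C * m (Metric.closedBall z δ) := by
  simpa using measure_closedBall_le_pow h.radius_pos h.le 1 (by simpa using hz)

/-- The masses of discs of radius `δ` vary at most exponentially. -/
lemma RestrictedDoubling.exists_growth (h : RestrictedDoubling m δ N C) :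
    ∃ A c : ℝ, 0 < A ∧ 0 ≤ c ∧ ∀ z z' : ℂ, m (Metric.closedBall z' δ) ≤
      ENNReal.ofReal (A * Real.exp (c * dist z z')) * m (Metric.closedBall z δ) := by
  have hδ := h.radius_pos
  have hD : 2 ^ N * C ≠ ∞ := by have := h.const_ne_top; finiteness
  -- The maximum with 1 makes log A ≥ 0, so the number of links can be rounded up to `dist z z' / δ
  -- + 1`.
  set A := max 1 (2 ^ N * C).toReal with hA
  have hA1 : 1 ≤ A := le_max_left _ _
  have hlog : 0 ≤ Real.log A := Real.log_nonneg hA1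
  refine ⟨A, Real.log A / δ, by positivity, by positivity, fun z z' => ?_⟩
  refine (measure_closedBall_le_pow hδ h.le ⌈dist z z' / δ⌉₊
    ((div_le_iff₀ hδ).1 (Nat.le_ceil _))).trans ?_
  gcongr
  calc (2 ^ N * C) ^ ⌈dist z z' / δ⌉₊ ≤ ENNReal.ofReal A ^ ⌈dist z z' / δ⌉₊ := by
        gcongr
        rw [← ENNReal.ofReal_toReal hD]
        exact ENNReal.ofReal_le_ofReal (le_max_right _ _)
    _ = ENNReal.ofReal (A ^ ⌈dist z z' / δ⌉₊) := by rw [ENNReal.ofReal_pow (by positivity)]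
    _ ≤ _ := by
      gcongr
      have h1 : (⌈dist z z' / δ⌉₊ : ℝ) ≤ dist z z' / δ + 1 :=
        (Nat.ceil_lt_add_one (by positivity)).le
      calc A ^ ⌈dist z z' / δ⌉₊ = A ^ (⌈dist z z' / δ⌉₊ : ℝ) := (Real.rpow_natCast _ _).symm
        _ ≤ A ^ (dist z z' / δ + 1) := Real.rpow_le_rpow_of_exponent_le hA1 h1
        _ = A * Real.exp (Real.log A / δ * dist z z') := by
          rw [Real.rpow_add (by positivity), Real.rpow_one, Real.rpow_def_of_pos (by positivity),
            mul_comm]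
          congr 2
          ring

lemma measurable_measure_closedBall (m : Measure ℂ) [SFinite m] (δ : ℝ) :
    Measurable fun z => m (Metric.closedBall z δ) := by
  have : MeasurableSet {p : ℂ × ℂ | dist p.2 p.1 ≤ δ} :=
    (isClosed_le (by fun_prop) (by fun_prop)).measurableSet
  exact measurable_measure_prodMk_left this

/-- A double counting inequality: a function integrated against one measure is
compared with a function integrated against another measure, at distance `δ`. -/
lemma lintegral_mul_measure_closedBall_le (m₁ m₂ : Measure ℂ) [SFinite m₁] [SFinite m₂]
    {g₁ g₂ : ℂ → ℝ≥0∞} (hg₂ : Measurable g₂) (δ : ℝ)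
    (hle : ∀ x y, dist x y ≤ δ → g₁ x ≤ g₂ y) :
    ∫⁻ x, g₁ x * m₂ (Metric.closedBall x δ) ∂m₁ ≤
      ∫⁻ y, g₂ y * m₁ (Metric.closedBall y δ) ∂m₂ := by
  set S : Set (ℂ × ℂ) := {p | dist p.1 p.2 ≤ δ} with hS
  have hSm : MeasurableSet S := (isClosed_le (by fun_prop) (by fun_prop)).measurableSet
  calc ∫⁻ x, g₁ x * m₂ (Metric.closedBall x δ) ∂m₁
      = ∫⁻ x, ∫⁻ y, (Metric.closedBall x δ).indicator (fun _ => g₁ x) y ∂m₂ ∂m₁ := by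
        refine lintegral_congr fun x => ?_
        rw [lintegral_indicator_const Metric.isClosed_closedBall.measurableSet]
    _ ≤ ∫⁻ x, ∫⁻ y, S.indicator (fun p => g₂ p.2) (x, y) ∂m₂ ∂m₁ := by
        refine lintegral_mono fun x => lintegral_mono fun y => ?_
        by_cases hxy : dist x y ≤ δ
        · rw [Set.indicator_of_mem (by rwa [Metric.mem_closedBall']),
            Set.indicator_of_mem (by exact hxy)]
          exact hle x y hxy
        · rw [Set.indicator_of_notMem (by rwa [Metric.mem_closedBall'])]
          exact zero_le
    _ = ∫⁻ y, ∫⁻ x, S.indicator (fun p => g₂ p.2) (x, y) ∂m₁ ∂m₂ :=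
        lintegral_lintegral_swap
          ((hg₂.comp measurable_snd).indicator hSm).aemeasurable
    _ = ∫⁻ y, ∫⁻ x, (Metric.closedBall y δ).indicator (fun _ => g₂ y) x ∂m₁ ∂m₂ := by
        refine lintegral_congr fun y => lintegral_congr fun x => ?_
        by_cases hxy : dist x y ≤ δ
        · rw [Set.indicator_of_mem (by exact hxy), Set.indicator_of_mem (by exact hxy)]
        · rw [Set.indicator_of_notMem (by exact hxy), Set.indicator_of_notMem (by exact hxy)]
    _ = _ := by
        refine lintegral_congr fun x => ?_
        rw [lintegral_indicator_const Metric.isClosed_closedBall.measurableSet]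

lemma RestrictedDoubling.div_le_of_dist_le (h : RestrictedDoubling m δ N C) {z z' : ℂ}
    (hz : dist z z' ≤ δ) {x y : ℝ≥0∞} (hxy : x ≤ y) :
    x / m (Metric.closedBall z δ) ≤ 2 ^ N * C * y / m (Metric.closedBall z' δ) := by
  rw [ENNReal.div_le_iff (h.ne_zero _) (h.ne_top _), ← ENNReal.mul_div_right_comm,
    ENNReal.le_div_iff_mul_le (.inl (h.ne_zero _)) (.inl (h.ne_top _))]
  calc x * m (Metric.closedBall z' δ)
      ≤ y * (2 ^ N * C * m (Metric.closedBall z δ)) := by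
        gcongr
        exact h.measure_le_of_dist_le hz
    _ = _ := by ring

variable [SFinite m]

/-- Double counting of m against Lebesgue measure: all discs of radius δ have the same area, and W
is essentially constant on them, so dm/W is dominated by dA for integrands with `g z ≤ g' η` at
distance δ. -/
lemma RestrictedDoubling.lintegral_div_le (h : RestrictedDoubling m δ N C) {g g' : ℂ → ℝ≥0∞}
    (hg' : Measurable g') (hle : ∀ z η, dist z η ≤ δ → g z ≤ g' η) :
    (∫⁻ z, g z / m (Metric.closedBall z δ) ∂m) * volume (Metric.closedBall (0 : ℂ) δ) ≤
      2 ^ N * C * ∫⁻ η, g' η := by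
  have hvol : volume (Metric.closedBall (0 : ℂ) δ) ≠ ∞ :=
    (isCompact_closedBall _ _).measure_lt_top.ne
  have hD : 2 ^ N * C ≠ ∞ := by have := h.const_ne_top; finiteness
  rw [← lintegral_mul_const' _ _ hvol, ← lintegral_const_mul' _ _ hD]
  refine le_trans (le_of_eq ?_) ((lintegral_mul_measure_closedBall_le m volume
    (g₁ := fun z => g z / m (Metric.closedBall z δ))
    (g₂ := fun η => 2 ^ N * C * g' η / m (Metric.closedBall η δ))
    ((hg'.const_mul _).div (measurable_measure_closedBall m δ)) δ
    fun z η hz => h.div_le_of_dist_le hz (hle z η hz)).trans (le_of_eq ?_))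
  · refine lintegral_congr fun z => ?_
    rw [Measure.addHaar_closedBall_center volume z]
  · refine lintegral_congr fun z => ?_
    rw [ENNReal.div_mul_cancel (h.ne_zero _) (h.ne_top _)]

lemma RestrictedDoubling.lintegral_le (h : RestrictedDoubling m δ N C) {g g' : ℂ → ℝ≥0∞}
    (hg' : Measurable g') (hle : ∀ η z, dist η z ≤ δ → g η ≤ g' z) :
    ∫⁻ η, g η ≤ 2 ^ N * C * volume (Metric.closedBall (0 : ℂ) δ) *
      ∫⁻ z, g' z / m (Metric.closedBall z δ) ∂m := by
  have hvol : volume (Metric.closedBall (0 : ℂ) δ) ≠ ∞ :=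
    (isCompact_closedBall _ _).measure_lt_top.ne
  have hD : 2 ^ N * C * volume (Metric.closedBall (0 : ℂ) δ) ≠ ∞ := by
    have := h.const_ne_top; finiteness
  rw [← lintegral_const_mul' _ _ hD]
  refine le_trans (le_of_eq ?_) ((lintegral_mul_measure_closedBall_le volume m
    (g₁ := fun z => g z / m (Metric.closedBall z δ))
    (g₂ := fun η => 2 ^ N * C * g' η / m (Metric.closedBall η δ))
    ((hg'.const_mul _).div (measurable_measure_closedBall m δ)) δ
    fun z η hz => h.div_le_of_dist_le hz (hle z η hz)).trans (le_of_eq ?_))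
  · refine lintegral_congr fun z => ?_
    rw [ENNReal.div_mul_cancel (h.ne_zero _) (h.ne_top _)]
  · refine lintegral_congr fun z => ?_
    rw [Measure.addHaar_closedBall_center volume z]
    simp only [div_eq_mul_inv]
    ring

/-- Comparison with (1 + ‖z‖)^(-3), using x³/3! ≤ exp x at x = κ (1 + ‖z‖). -/
lemma integrable_exp_neg_mul_norm {κ : ℝ} (hκ : 0 < κ) :
    Integrable fun z : ℂ => Real.exp (-κ * ‖z‖) := by
  have h3 : Integrable fun z : ℂ => (1 + ‖z‖) ^ (-(3 : ℝ)) :=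
    integrable_one_add_norm (by rw [Complex.finrank_real_complex]; norm_num)
  refine (h3.const_mul (6 * Real.exp κ / κ ^ 3)).mono' (by fun_prop) (.of_forall fun z => ?_)
  rw [Real.norm_of_nonneg (Real.exp_pos _).le, Real.rpow_neg (by positivity),
    show (3 : ℝ) = ((3 : ℕ) : ℝ) by norm_num, Real.rpow_natCast]
  have h1 := Real.pow_div_factorial_le_exp (κ * (1 + ‖z‖)) (by positivity) 3
  have h2 : Real.exp (κ * (1 + ‖z‖)) = Real.exp κ * (Real.exp (-κ * ‖z‖))⁻¹ := by
    rw [← Real.exp_neg, ← Real.exp_add]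
    congr 1
    ring
  rw [h2] at h1
  have h4 := Real.exp_pos (-κ * ‖z‖)
  have h5 : (0 : ℝ) < 1 + ‖z‖ := by positivity
  norm_num [Nat.factorial] at h1
  field_simp at h1 ⊢
  nlinarith

/-- The bound is uniform in ξ because, after passing to dA, the integral is translation invariant.
-/
lemma RestrictedDoubling.exists_lintegral_exp_div_le (h : RestrictedDoubling m δ N C) {κ : ℝ}
    (hκ : 0 < κ) : ∃ M : ℝ≥0∞, M ≠ ∞ ∧ ∀ ξ : ℂ,
      ∫⁻ z, ENNReal.ofReal (Real.exp (-κ * ‖z - ξ‖)) / m (Metric.closedBall z δ) ∂m ≤ M := by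
  set V := volume (Metric.closedBall (0 : ℂ) δ)
  have hV0 : V ≠ 0 := (Metric.measure_closedBall_pos volume (0 : ℂ) h.radius_pos).ne'
  have hVt : V ≠ ∞ := (isCompact_closedBall _ _).measure_lt_top.ne
  set I := ∫⁻ η : ℂ, ENNReal.ofReal (Real.exp (κ * δ) * Real.exp (-κ * ‖η‖)) with hI
  have hIt : I ≠ ∞ := ((integrable_exp_neg_mul_norm hκ).const_mul _).lintegral_lt_top.ne
  have hC := h.const_ne_top
  refine ⟨2 ^ N * C * I / V, ENNReal.div_ne_top (by finiteness) hV0, fun ξ => ?_⟩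
  rw [ENNReal.le_div_iff_mul_le (.inl hV0) (.inl hVt)]
  refine (h.lintegral_div_le
    (g' := fun η => ENNReal.ofReal (Real.exp (κ * δ) * Real.exp (-κ * ‖η - ξ‖)))
    (by fun_prop) fun z η hz => ?_).trans (le_of_eq ?_)
  · rw [← Real.exp_add]
    gcongr
    have : ‖η - ξ‖ ≤ ‖z - ξ‖ + δ := by
      rw [← dist_eq_norm, ← dist_eq_norm]
      linarith [dist_triangle η z ξ, dist_comm z η]
    nlinarith
  · rw [hI, lintegral_sub_right_eq_self
      (fun η : ℂ => ENNReal.ofReal (Real.exp (κ * δ) * Real.exp (-κ * ‖η‖)))]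

/-- Here the real dimension 2 of the plane produces the threshold p > 2. -/
lemma RestrictedDoubling.lintegral_one_add_norm_rpow_lt_top (h : RestrictedDoubling m δ N C)
    {p : ℝ} (hp : 2 < p) :
    ∫⁻ z, ENNReal.ofReal ((1 + ‖z‖) ^ (-p)) / m (Metric.closedBall z δ) ∂m < ∞ := by
  set V := volume (Metric.closedBall (0 : ℂ) δ)
  have hδ := h.radius_pos
  have hV0 : V ≠ 0 := (Metric.measure_closedBall_pos volume (0 : ℂ) h.radius_pos).ne'
  have hVt : V ≠ ∞ := (isCompact_closedBall _ _).measure_lt_top.ne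
  have hI : ∫⁻ η : ℂ, ENNReal.ofReal ((1 + δ) ^ p * (1 + ‖η‖) ^ (-p)) < ∞ :=
    ((integrable_one_add_norm (by rw [Complex.finrank_real_complex]; exact_mod_cast hp)).const_mul
      _).lintegral_lt_top
  have hC := h.const_ne_top
  have := h.lintegral_div_le (g := fun z => ENNReal.ofReal ((1 + ‖z‖) ^ (-p)))
    (g' := fun η => ENNReal.ofReal ((1 + δ) ^ p * (1 + ‖η‖) ^ (-p))) (by fun_prop)
    fun z η hz => by
      gcongr
      have h1 : 1 + ‖η‖ ≤ (1 + δ) * (1 + ‖z‖) := by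
        have : ‖η‖ ≤ ‖z‖ + δ := by
          rw [dist_comm, dist_eq_norm] at hz
          linarith [norm_le_norm_add_norm_sub' η z]
        nlinarith [norm_nonneg z]
      rw [Real.rpow_neg (by positivity), Real.rpow_neg (by positivity), ← div_eq_mul_inv,
        le_div_iff₀ (by positivity), inv_mul_le_iff₀ (by positivity),
        ← Real.mul_rpow (by positivity) (by positivity)]
      rw [mul_comm]
      exact Real.rpow_le_rpow (by positivity) h1 (by linarith)
  rw [← ENNReal.le_div_iff_mul_le (.inl hV0) (.inl hVt)] at this
  exact this.trans_lt (ENNReal.div_lt_top (by finiteness) hV0)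

/-- In polar coordinates this is the divergence of ∫ dr/r. -/
lemma lintegral_norm_inv_sq_eq_top (R : ℝ) (hR : 0 < R) :
    ∫⁻ z : ℂ, ENNReal.ofReal ((Set.Ici R).indicator (fun x => (x ^ 2)⁻¹) ‖z‖) = ∞ := by
  by_contra hfin
  have hmeas : Measurable ((Set.Ici R).indicator fun x : ℝ => (x ^ 2)⁻¹) :=
    (by fun_prop : Measurable fun x : ℝ => (x ^ 2)⁻¹).indicator measurableSet_Ici
  have hint : Integrable (fun z : ℂ => (Set.Ici R).indicator (fun x : ℝ => (x ^ 2)⁻¹) ‖z‖) := by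
    refine ⟨(hmeas.comp measurable_norm).aestronglyMeasurable, ?_⟩
    rw [hasFiniteIntegral_iff_ofReal (.of_forall fun z => ?_)]
    · exact lt_top_iff_ne_top.2 hfin
    · exact Set.indicator_nonneg (fun x _ => by positivity) _
  rw [integrable_fun_norm_addHaar, Complex.finrank_real_complex] at hint
  refine not_integrableOn_Ioi_inv (a := R) ?_
  refine (hint.mono_set (Set.Ioi_subset_Ioi hR.le)).congr_fun (fun x hx => ?_) measurableSet_Ioi
  have hx' : R < x := hx
  have : x ≠ 0 := by linarith [hR]
  simp only [Set.indicator_of_mem (show x ∈ Set.Ici R from hx'.le), smul_eq_mul]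
  field_simp
  simp

lemma RestrictedDoubling.lintegral_norm_inv_sq_div_eq_top (h : RestrictedDoubling m δ N C) :
    ∫⁻ z, ENNReal.ofReal ((Set.Ici 1).indicator (fun x => (x ^ 2)⁻¹) ‖z‖) /
      m (Metric.closedBall z δ) ∂m = ∞ := by
  have hδ := h.radius_pos
  have hmeas : Measurable ((Set.Ici 1).indicator fun x : ℝ => (x ^ 2)⁻¹) :=
    (by fun_prop : Measurable fun x : ℝ => (x ^ 2)⁻¹).indicator measurableSet_Ici
  -- Cutting off at 1 + δ keeps the neighbouring point z outside the unit disc. There ‖z‖ ≤ 2‖η‖,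
  -- whence the factor 1/4.
  have h1 := h.lintegral_le
    (g := fun z => ENNReal.ofReal ((Set.Ici (1 + δ)).indicator (fun x => (x ^ 2)⁻¹) ‖z‖) *
      ENNReal.ofReal (1 / 4))
    (g' := fun z => ENNReal.ofReal ((Set.Ici 1).indicator (fun x => (x ^ 2)⁻¹) ‖z‖))
    (hmeas.comp measurable_norm).ennreal_ofReal
    fun η z hz => by
      by_cases hη : 1 + δ ≤ ‖η‖
      · rw [dist_eq_norm] at hz
        have h2 : 1 ≤ ‖z‖ := by linarith [norm_le_norm_add_norm_sub' η z]
        have h3 : ‖z‖ ≤ 2 * ‖η‖ := by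
          linarith [norm_le_norm_add_norm_sub' z η, norm_sub_rev η z]
        rw [Set.indicator_of_mem (show ‖η‖ ∈ Set.Ici (1 + δ) from hη),
          Set.indicator_of_mem (show ‖z‖ ∈ Set.Ici 1 from h2),
          ← ENNReal.ofReal_mul (by positivity)]
        gcongr
        have : 0 < ‖η‖ := by linarith
        rw [one_div, ← mul_inv]
        gcongr
        nlinarith [norm_nonneg z]
      · rw [Set.indicator_of_notMem (show ‖η‖ ∉ Set.Ici (1 + δ) from hη)]
        simp
  rw [lintegral_mul_const' _ _ ENNReal.ofReal_ne_top,
    lintegral_norm_inv_sq_eq_top _ (by linarith), ENNReal.top_mul (by simp)] at h1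
  by_contra hne
  have hC := h.const_ne_top
  have hVt : volume (Metric.closedBall (0 : ℂ) δ) ≠ ∞ :=
    (isCompact_closedBall _ _).measure_lt_top.ne
  exact absurd (top_le_iff.1 h1) (by finiteness)

end

/-! ### Local mean value estimates for entire functions -/

section

variable {m : Measure ℂ} {δ : ℝ} {N : ℕ} {C : ℝ≥0∞}

/-- An entire function is comparable to its value at a suitable point on a disc around it, whose
radius controls the size of the function at the centre. -/
lemma exists_closedBall_half_le_norm {G : ℂ → ℂ} (hG : Differentiable ℂ G) {δ : ℝ} (hδ : 0 < δ)
    (N : ℕ) {z : ℂ} (hz : G z ≠ 0) :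
    ∃ (c : ℂ) (t : ℝ), 0 < t ∧ t ≤ 1 ∧ ‖G z‖ ≤ ‖G c‖ * t ^ (N + 1) ∧
      Metric.closedBall c (t * δ / (4 * (2 ^ (N + 1) + 1))) ⊆ Metric.closedBall z δ ∧
      ∀ ζ ∈ Metric.closedBall c (t * δ / (4 * (2 ^ (N + 1) + 1))), ‖G c‖ / 2 ≤ ‖G ζ‖ := by
  set n := N + 1
  -- The point c maximises |G| times the n-th power of the relative distance to the boundary, and t
  -- is that distance at c. On D(c, tδ/2) the distance is at least t/2, so |G| ≤ 2^n |G(c)| there.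
  -- The Schwarz lemma then keeps G within |G(c)|/2 of G(c) on the disc of radius tδ/(4(2^n + 1)).
  obtain ⟨c, hc, hmax⟩ := (isCompact_closedBall z δ).exists_isMaxOn
    ⟨z, Metric.mem_closedBall_self hδ.le⟩
    (f := fun ζ => ‖G ζ‖ * (1 - ‖ζ - z‖ / δ) ^ n)
    (by have := hG.continuous; fun_prop)
  set t := 1 - ‖c - z‖ / δ with ht
  rw [Metric.mem_closedBall, dist_eq_norm] at hc
  have h1 : ‖G z‖ ≤ ‖G c‖ * t ^ n := by
    have := hmax (Metric.mem_closedBall_self hδ.le)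
    simpa using this
  have hGz : 0 < ‖G z‖ := norm_pos_iff.2 hz
  have ht0 : 0 ≤ t := by
    rw [ht, sub_nonneg, div_le_one hδ]
    exact hc
  have htpos : 0 < t := by
    refine lt_of_le_of_ne ht0 fun h => ?_
    rw [← h, zero_pow (by simp [n]), mul_zero] at h1
    linarith
  have ht1 : t ≤ 1 := by
    rw [ht]
    have : 0 ≤ ‖c - z‖ / δ := by positivity
    linarith
  have hGc : 0 < ‖G c‖ := by
    by_contra h
    have h0 : ‖G c‖ = 0 := le_antisymm (not_lt.1 h) (norm_nonneg _)
    rw [h0, zero_mul] at h1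
    linarith
  have hcz : ‖c - z‖ = δ - t * δ := by rw [ht]; field_simp; ring
  set a : ℝ := 2 ^ n with ha
  have ha1 : 1 ≤ a := one_le_pow₀ one_le_two
  have hρ : t * δ / (4 * (a + 1)) ≤ t * δ / 4 :=
    div_le_div_of_nonneg_left (by positivity) (by positivity) (by linarith)
  have htδ : 0 < t * δ := by positivity
  refine ⟨c, t, htpos, ht1, h1, ?_, fun ζ hζ => ?_⟩
  · refine Metric.closedBall_subset_closedBall' ?_
    rw [dist_eq_norm]
    linarith
  have hmaps : Set.MapsTo G (Metric.ball c (t * δ / 2))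
      (Metric.closedBall (G c) ((a + 1) * ‖G c‖)) := by
    intro ξ hξ
    rw [Metric.mem_ball, dist_eq_norm] at hξ
    have hξz : ‖ξ - z‖ ≤ δ - t * δ / 2 := by
      calc ‖ξ - z‖ ≤ ‖ξ - c‖ + ‖c - z‖ := norm_sub_le_norm_sub_add_norm_sub _ _ _
        _ ≤ _ := by linarith
    have h2 : ‖G ξ‖ * (1 - ‖ξ - z‖ / δ) ^ n ≤ ‖G c‖ * t ^ n :=
      hmax (Metric.mem_closedBall.2 (by rw [dist_eq_norm]; linarith))
    have h3 : t / 2 ≤ 1 - ‖ξ - z‖ / δ := by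
      rw [le_sub_comm, div_le_iff₀ hδ]
      linarith
    have h4 : ‖G ξ‖ ≤ a * ‖G c‖ := by
      have h5 : ‖G ξ‖ * (t / 2) ^ n ≤ ‖G c‖ * t ^ n := by
        refine le_trans ?_ h2
        gcongr
      rw [div_pow, ← ha, mul_div_assoc', div_le_iff₀ (by positivity)] at h5
      have h6 : 0 < t ^ n := by positivity
      nlinarith
    rw [Metric.mem_closedBall, dist_eq_norm]
    calc ‖G ξ - G c‖ ≤ ‖G ξ‖ + ‖G c‖ := norm_sub_le _ _
      _ ≤ _ := by linarith
  rw [Metric.mem_closedBall] at hζ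
  have h7 := Complex.dist_le_div_mul_dist_of_mapsTo_ball hG.differentiableOn hmaps
    (Metric.mem_ball.2 (by linarith : dist ζ c < t * δ / 2))
  have h8 : (a + 1) * ‖G c‖ / (t * δ / 2) * dist ζ c ≤ ‖G c‖ / 2 := by
    calc (a + 1) * ‖G c‖ / (t * δ / 2) * dist ζ c
        ≤ (a + 1) * ‖G c‖ / (t * δ / 2) * (t * δ / (4 * (a + 1))) := by gcongr
      _ = ‖G c‖ / 2 := by field_simp; norm_num
  rw [dist_eq_norm] at h7
  linarith [norm_le_norm_add_norm_sub (G ζ) (G c)]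

/-- The local mean value estimate for entire functions with respect to a measure which is doubling
at a fixed scale. -/
lemma RestrictedDoubling.exists_enorm_sq_mul_measure_le (h : RestrictedDoubling m δ N C) :
    ∃ B : ℝ≥0∞, B ≠ ∞ ∧ ∀ G : ℂ → ℂ, Differentiable ℂ G → ∀ z,
      ‖G z‖ₑ ^ 2 * m (Metric.closedBall z δ) ≤
        B * ∫⁻ ζ in Metric.closedBall z δ, ‖G ζ‖ₑ ^ 2 ∂m := by
  have hδ := h.radius_pos
  have hC := h.const_ne_top
  set K : ℝ := 4 * (2 ^ (N + 1) + 1) with hK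
  refine ⟨ENNReal.ofReal (4 * K ^ N) * C, by finiteness, fun G hG z => ?_⟩
  rcases eq_or_ne (G z) 0 with hz | hz
  · simp [hz]
  obtain ⟨c, t, ht0, ht1, hle, hsub, hhalf⟩ := exists_closedBall_half_le_norm hG hδ N hz
  set ρ := t * δ / K
  have hK1 : 1 ≤ K := by
    have : (0 : ℝ) < 2 ^ (N + 1) := by positivity
    rw [hK]
    linarith
  have hρ : 0 < ρ := by positivity
  have hρδ : ρ ≤ δ := (div_le_self (by positivity) hK1).trans (by nlinarith)
  have h1 := h.le z c ρ hρ hρδ hsub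
  have e1 : ∀ ξ, ‖G ξ‖ₑ ^ 2 = ENNReal.ofReal (‖G ξ‖ ^ 2) := fun ξ => by
    rw [ENNReal.ofReal_pow (norm_nonneg _), ofReal_norm]
  -- The factor t^(2(N+1)) gained by the choice of c pays for the doubling loss (ρ/δ)^N = (t/K)^N,
  -- however small t is.
  have h2 : ‖G z‖ₑ ^ 2 ≤ ENNReal.ofReal (K ^ N * ‖G c‖ ^ 2) * ENNReal.ofReal ((ρ / δ) ^ N) := by
    rw [e1, ← ENNReal.ofReal_mul (by positivity)]
    refine ENNReal.ofReal_le_ofReal ?_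
    calc ‖G z‖ ^ 2 ≤ (‖G c‖ * t ^ (N + 1)) ^ 2 := by gcongr
      _ = ‖G c‖ ^ 2 * t ^ ((N + 1) * 2) := by rw [mul_pow, ← pow_mul]
      _ ≤ ‖G c‖ ^ 2 * t ^ N := by
        gcongr ?_ * ?_
        exact pow_le_pow_of_le_one ht0.le ht1 (by omega)
      _ = K ^ N * ‖G c‖ ^ 2 * (ρ / δ) ^ N := by
        have : ρ / δ = t / K := by simp only [ρ]; field_simp
        rw [this, div_pow]
        field_simp
  calc ‖G z‖ₑ ^ 2 * m (Metric.closedBall z δ)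
      ≤ ENNReal.ofReal (K ^ N * ‖G c‖ ^ 2) * ENNReal.ofReal ((ρ / δ) ^ N) *
        m (Metric.closedBall z δ) := by gcongr
    _ ≤ ENNReal.ofReal (K ^ N * ‖G c‖ ^ 2) * (C * m (Metric.closedBall c ρ)) := by
        rw [mul_assoc]
        gcongr
    _ = ENNReal.ofReal (4 * K ^ N) * C *
        (ENNReal.ofReal ((‖G c‖ / 2) ^ 2) * m (Metric.closedBall c ρ)) := by
        rw [show K ^ N * ‖G c‖ ^ 2 = 4 * K ^ N * (‖G c‖ / 2) ^ 2 by ring,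
          ENNReal.ofReal_mul (by positivity)]
        ring
    _ = ENNReal.ofReal (4 * K ^ N) * C *
        ∫⁻ _ in Metric.closedBall c ρ, ENNReal.ofReal ((‖G c‖ / 2) ^ 2) ∂m := by
        rw [setLIntegral_const]
    _ ≤ ENNReal.ofReal (4 * K ^ N) * C * ∫⁻ ζ in Metric.closedBall c ρ, ‖G ζ‖ₑ ^ 2 ∂m := by
        gcongr _ * ?_
        refine setLIntegral_mono'
          (measurableSet_closedBall : MeasurableSet (Metric.closedBall c ρ)) fun ζ hζ => ?_
        rw [e1]
        gcongr
        exact hhalf ζ hζ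
    _ ≤ _ := by gcongr

/-- The square of the modulus of `F` times the Gaussian weight. -/
noncomputable def gaussSq (α : ℝ) (F : ℂ → ℂ) (z : ℂ) : ℝ≥0∞ :=
  ENNReal.ofReal (Real.exp (-α * ‖z‖ ^ 2)) * ‖F z‖ₑ ^ 2

lemma measurable_gaussSq (α : ℝ) {F : ℂ → ℂ} (hF : Differentiable ℂ F) :
    Measurable (gaussSq α F) := by
  have := hF.continuous.measurable
  unfold gaussSq
  fun_prop

lemma gaussSq_eq_ofReal (α : ℝ) (F : ℂ → ℂ) (z : ℂ) :
    gaussSq α F z = ENNReal.ofReal (Real.exp (-α * ‖z‖ ^ 2) * ‖F z‖ ^ 2) := by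
  rw [gaussSq, ENNReal.ofReal_mul (Real.exp_pos _).le, ENNReal.ofReal_pow (norm_nonneg _),
    ofReal_norm]

/-- Multiplication by `exp (-α z̄ ζ)` centres the Gaussian weight at `z`. -/
lemma gaussSq_eq_exp_mul (α : ℝ) (F : ℂ → ℂ) (z ζ : ℂ) :
    ‖F ζ * Complex.exp (-α * (starRingEnd ℂ z * ζ))‖ₑ ^ 2 =
      ENNReal.ofReal (Real.exp (α * ‖ζ - z‖ ^ 2 - α * ‖z‖ ^ 2)) * gaussSq α F ζ := by
  rw [gaussSq_eq_ofReal, ← ENNReal.ofReal_mul (Real.exp_pos _).le, ← ofReal_norm,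
    ← ENNReal.ofReal_pow (norm_nonneg _), norm_mul, Complex.norm_exp, mul_pow,
    ← Real.exp_nat_mul, mul_comm (‖F ζ‖ ^ 2), ← mul_assoc (Real.exp _), ← Real.exp_add]
  congr 3
  have h1 : ‖ζ - z‖ ^ 2 = ‖ζ‖ ^ 2 - 2 * (z.re * ζ.re + z.im * ζ.im) + ‖z‖ ^ 2 := by
    rw [← Complex.normSq_eq_norm_sq, ← Complex.normSq_eq_norm_sq, ← Complex.normSq_eq_norm_sq,
      Complex.normSq_apply, Complex.normSq_apply, Complex.normSq_apply, Complex.sub_re,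
      Complex.sub_im]
    ring
  rw [h1]
  simp
  ring

/-- The local mean value estimate with the Gaussian weight. -/
lemma RestrictedDoubling.exists_gaussSq_mul_measure_le (h : RestrictedDoubling m δ N C) (α : ℝ)
    (hα : 0 < α) :
    ∃ B : ℝ≥0∞, B ≠ ∞ ∧ ∀ F : ℂ → ℂ, Differentiable ℂ F → ∀ z,
      gaussSq α F z * m (Metric.closedBall z δ) ≤
        B * ∫⁻ ζ in Metric.closedBall z δ, gaussSq α F ζ ∂m := by
  obtain ⟨B, hB, hle⟩ := h.exists_enorm_sq_mul_measure_le
  refine ⟨B * ENNReal.ofReal (Real.exp (α * δ ^ 2)), by finiteness, fun F hF z => ?_⟩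
  -- The exponential factor turns the Gaussian into e^{α|ζ-z|²}, which lies between 1 and e^{αδ²} on
  -- the disc, up to the constant E that cancels.
  have h1 := hle (fun ζ => F ζ * Complex.exp (-α * (starRingEnd ℂ z * ζ)))
    (by fun_prop) z
  simp only [gaussSq_eq_exp_mul] at h1
  set E : ℝ≥0∞ := ENNReal.ofReal (Real.exp (-(α * ‖z‖ ^ 2))) with hE
  have hE0 : E ≠ 0 := by simp [hE, Real.exp_pos]
  have hEt : E ≠ ∞ := ENNReal.ofReal_ne_top
  rw [sub_self, norm_zero, zero_pow two_ne_zero, mul_zero, zero_sub, ← hE] at h1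
  rw [← ENNReal.mul_le_mul_iff_right hE0 hEt]
  calc E * (gaussSq α F z * m (Metric.closedBall z δ))
      = E * gaussSq α F z * m (Metric.closedBall z δ) := by ring
    _ ≤ _ := h1
    _ ≤ B * ∫⁻ ζ in Metric.closedBall z δ,
        ENNReal.ofReal (Real.exp (α * δ ^ 2)) * E * gaussSq α F ζ ∂m := by
      gcongr _ * ?_
      refine setLIntegral_mono'
        (measurableSet_closedBall : MeasurableSet (Metric.closedBall z δ)) fun ζ hζ => ?_
      gcongr ?_ * _
      rw [hE, ← ENNReal.ofReal_mul (Real.exp_pos _).le, ← Real.exp_add]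
      rw [Metric.mem_closedBall, dist_eq_norm] at hζ
      gcongr
      rw [sub_eq_add_neg]
      gcongr
    _ = _ := by
      rw [lintegral_const_mul' _ _ (by finiteness)]
      ring

end

/-! ### Schatten membership from sums over orthonormal families -/

section Enumeration

/-- A positive function with finite superlevel sets can be enumerated in decreasing order. -/
lemma exists_decreasing_enumeration {J : Type*} {s : J → ℝ} (hs : ∀ j, 0 < s j)
    (hfin : ∀ ε : ℝ, 0 < ε → {j | ε ≤ s j}.Finite) :
    ∃ f : J → ℕ, Function.Injective f ∧ (∀ i j, s j < s i → f i < f j) ∧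
      ∀ i n, n < f i → ∃ j, f j = n := by
  have hcount : Countable J := by
    rw [← Set.countable_univ_iff]
    have : (Set.univ : Set J) = ⋃ n : ℕ, {j | 1 / ((n : ℝ) + 1) ≤ s j} := by
      symm
      rw [Set.eq_univ_iff_forall]
      intro j
      obtain ⟨n, hn⟩ := exists_nat_one_div_lt (hs j)
      exact Set.mem_iUnion.2 ⟨n, hn.le⟩
    rw [this]
    exact Set.countable_iUnion fun n => (hfin _ (by positivity)).countable
  obtain ⟨g, hg⟩ := exists_injective_nat J
  -- Larger values of s come first and ties are broken by the injection g. The position of j is the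
  -- number of smaller keys, finite because superlevel sets are.
  set key : J → ℝ ×ₗ ℕ := fun j => toLex (-s j, g j) with hkey
  have hinj : Function.Injective key := fun i j hij => by
    have := congrArg (fun x => (ofLex x).2) hij
    exact hg this
  have hsub : ∀ i, {j | key j < key i} ⊆ {j | s i ≤ s j} := fun i j hj => by
    rcases Prod.Lex.lt_iff.1 hj with h | ⟨h, -⟩
    · exact (neg_lt_neg_iff.1 h).le
    · exact (neg_inj.1 h).ge
  have hfi : ∀ i, {j | key j < key i}.Finite := fun i => (hfin _ (hs i)).subset (hsub i)
  set f : J → ℕ := fun i => {j | key j < key i}.ncard with hf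
  have hmono : ∀ i j, key i < key j → f i < f j := fun i j hij => by
    refine Set.ncard_lt_ncard ⟨fun k (hk : key k < key i) => hk.trans hij, fun h => ?_⟩ (hfi j)
    have hi : i ∈ {k | key k < key i} := h (show i ∈ {k | key k < key j} from hij)
    exact lt_irrefl (key i) hi
  have hfinj : Function.Injective f := fun i j hij => by
    by_contra hne
    rcases lt_or_gt_of_ne (hinj.ne hne) with h | h
    · exact (hmono _ _ h).ne hij
    · exact (hmono _ _ h).ne' hij
  refine ⟨f, hfinj, fun i j hij => hmono i j (Prod.Lex.lt_iff.2 (.inl (neg_lt_neg hij))), ?_⟩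
  intro i n hn
  have himg : f '' {j | key j < key i} = Set.Iio (f i) := by
    refine Set.eq_of_subset_of_ncard_le ?_ ?_ (Set.finite_Iio _)
    · rintro _ ⟨j, hj, rfl⟩
      exact hmono j i hj
    · rw [Set.ncard_image_of_injective _ hfinj]
      simp [hf]
  obtain ⟨j, -, hj⟩ := himg.ge hn
  exact ⟨j, hj⟩

end Enumeration

section Hilbert

universe u

variable {H : Type u} [NormedAddCommGroup H] [InnerProductSpace ℂ H]

lemma sum_norm_rpow_le_of_orthonormal {T : H →L[ℂ] H} {p M : ℝ}
    (hM : ∀ (n : ℕ) (e : Fin n → H), Orthonormal ℂ e → ∑ i, ‖T (e i)‖ ^ p ≤ M)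
    {κ : Type*} {e : κ → H} (he : Orthonormal ℂ e) (t : Finset κ) :
    ∑ i ∈ t, ‖T (e i)‖ ^ p ≤ M := by
  have h := hM t.card (fun i => e (t.equivFin.symm i))
    (he.comp _ (Subtype.val_injective.comp t.equivFin.symm.injective))
  rw [t.equivFin.symm.sum_comp (fun i : t => ‖T (e i)‖ ^ p)] at h
  rwa [← Finset.sum_coe_sort]

lemma finite_setOf_le_norm_of_orthonormal {T : H →L[ℂ] H} {p M : ℝ} (hp : 0 < p)
    (hM : ∀ (n : ℕ) (e : Fin n → H), Orthonormal ℂ e → ∑ i, ‖T (e i)‖ ^ p ≤ M)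
    {κ : Type*} {e : κ → H} (he : Orthonormal ℂ e) {ε : ℝ} (hε : 0 < ε) :
    {i | ε ≤ ‖T (e i)‖}.Finite := by
  by_contra hinf
  obtain ⟨n, hn⟩ := exists_nat_gt (M / ε ^ p)
  obtain ⟨t, ht, htn⟩ := (show Set.Infinite {i | ε ≤ ‖T (e i)‖} from hinf).exists_subset_card_eq n
  have h1 := sum_norm_rpow_le_of_orthonormal hM he t
  have h2 : ∑ i ∈ t, ε ^ p ≤ ∑ i ∈ t, ‖T (e i)‖ ^ p := by
    refine Finset.sum_le_sum fun i hi => ?_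
    have : ε ≤ ‖T (e i)‖ := ht hi
    gcongr
  rw [Finset.sum_const, htn, nsmul_eq_mul] at h2
  rw [div_lt_iff₀ (by positivity)] at hn
  linarith

/-- Otherwise, choosing successively a unit vector orthogonal to the previous ones with ‖T x‖ ≥ ε
gives orthonormal families of every length n, and n ε^p ≤ M fails for large n. -/
lemma exists_finiteDimensional_norm_le {T : H →L[ℂ] H} {p M : ℝ} (hp : 0 < p)
    (hM : ∀ (n : ℕ) (e : Fin n → H), Orthonormal ℂ e → ∑ i, ‖T (e i)‖ ^ p ≤ M)
    {ε : ℝ} (hε : 0 < ε) :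
    ∃ V : Submodule ℂ H, FiniteDimensional ℂ V ∧ ∀ x ∈ Vᗮ, ‖T x‖ ≤ ε * ‖x‖ := by
  by_contra! hcon
  have key : ∀ n : ℕ, ∃ e : Fin n → H, Orthonormal ℂ e ∧ ∀ i, ε ≤ ‖T (e i)‖ := by
    intro n
    induction n with
    | zero => exact ⟨Fin.elim0, ⟨fun i => i.elim0, fun i => i.elim0⟩, fun i => i.elim0⟩
    | succ n ih =>
      obtain ⟨e, he, hT⟩ := ih
      obtain ⟨x, hx, hxT⟩ := hcon (Submodule.span ℂ (Set.range e))
        (FiniteDimensional.span_of_finite ℂ (Set.finite_range e))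
      have hx0 : x ≠ 0 := by
        rintro rfl
        simp at hxT
      have hnx : 0 < ‖x‖ := norm_pos_iff.2 hx0
      have horth : ∀ i, inner ℂ (e i) x = 0 := fun i =>
        (Submodule.mem_orthogonal _ _).1 hx _ (Submodule.subset_span ⟨i, rfl⟩)
      set y : H := ((‖x‖⁻¹ : ℝ) : ℂ) • x with hy
      have hey : ∀ i, inner ℂ (e i) y = 0 := fun i => by
        rw [hy, inner_smul_right, horth, mul_zero]
      have hye : ∀ i, inner ℂ y (e i) = 0 := fun i => by
        rw [← inner_conj_symm, hey, map_zero]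
      have hny : ‖y‖ = 1 := by
        rw [hy, norm_smul, Complex.norm_real, norm_inv, norm_norm, inv_mul_cancel₀ hnx.ne']
      refine ⟨Fin.cons y e, ⟨fun i => ?_, fun i j hij => ?_⟩, fun i => ?_⟩
      · refine Fin.cases ?_ (fun i => ?_) i
        · simpa using hny
        · simpa using he.1 i
      · induction i using Fin.cases with
        | zero =>
          induction j using Fin.cases with
          | zero => exact absurd rfl hij
          | succ j => simpa using hye j
        | succ i =>
          induction j using Fin.cases with
          | zero => simpa using hey i
          | succ j => simpa using he.2 (fun h => hij (by rw [h]))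
      · refine Fin.cases ?_ (fun i => ?_) i
        · rw [Fin.cons_zero, hy, map_smul, norm_smul, Complex.norm_real, norm_inv, norm_norm,
            inv_mul_eq_div, le_div_iff₀ hnx]
          exact hxT.le
        · simpa using hT i
  obtain ⟨n, hn⟩ := exists_nat_gt (M / ε ^ p)
  obtain ⟨e, he, hT⟩ := key n
  have h1 := hM n e he
  have h2 : ∑ i : Fin n, ε ^ p ≤ ∑ i, ‖T (e i)‖ ^ p := by
    refine Finset.sum_le_sum fun i _ => ?_
    have := hT i
    gcongr
  rw [Finset.sum_const, Finset.card_univ, Fintype.card_fin, nsmul_eq_mul] at h2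
  rw [div_lt_iff₀ (by positivity)] at hn
  linarith

/-- T is the norm limit of the finite rank operators T P_k, with P_k the projection onto the space
given by the previous lemma for ε = 1/(k+1). -/
lemma isCompactOperator_of_sum_norm_rpow_le [CompleteSpace H] {T : H →L[ℂ] H} {p M : ℝ} (hp : 0 < p)
    (hM : ∀ (n : ℕ) (e : Fin n → H), Orthonormal ℂ e → ∑ i, ‖T (e i)‖ ^ p ≤ M) :
    IsCompactOperator T := by
  choose V hV hVT using fun k : ℕ =>
    exists_finiteDimensional_norm_le hp hM (Nat.one_div_pos_of_nat (α := ℝ) (n := k))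
  have hproj : ∀ k, (V k).HasOrthogonalProjection := fun k => inferInstance
  refine isCompactOperator_of_tendsto (l := atTop)
    (F := fun k => T ∘L (V k).subtypeL ∘L (V k).orthogonalProjectionOnto) ?_ (.of_forall fun k => ?_)
  · rw [tendsto_iff_norm_sub_tendsto_zero]
    refine squeeze_zero (fun _ => norm_nonneg _) (fun k => ?_)
      tendsto_one_div_add_atTop_nhds_zero_nat
    refine ContinuousLinearMap.opNorm_le_bound _ (by positivity) fun x => ?_
    set y : H := x - (V k).starProjection x with hy
    have h1 : y ∈ (V k)ᗮ := Submodule.sub_starProjection_mem_orthogonal x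
    have h2 : ‖y‖ ≤ ‖x‖ := by
      have := Submodule.norm_sq_eq_add_norm_sq_starProjection x (V k)
      have h3 : (V k)ᗮ.starProjection x = y := by
        rw [Submodule.starProjection_orthogonal_val]
      rw [h3] at this
      exact le_of_sq_le_sq (by nlinarith [norm_nonneg ((V k).starProjection x)]) (norm_nonneg _)
    have h4 : (T ∘L (V k).subtypeL ∘L (V k).orthogonalProjectionOnto - T) x = -T y := by
      rw [hy, map_sub, neg_sub]
      rfl
    rw [h4, norm_neg]
    refine (hVT k y h1).trans ?_
    gcongr
  · have := FiniteDimensional.proper ℂ (V k)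
    exact (isCompactOperator_of_locallyCompactSpace_dom
      (V k).orthogonalProjectionOnto).clm_comp (T ∘L (V k).subtypeL)

/-- A compact symmetric operator has a Hilbert basis of eigenvectors. -/
lemma exists_hilbertBasis_eigenvectors [CompleteSpace H] {A : H →L[ℂ] H} (hA : IsCompactOperator A)
    (hA' : A.IsSymmetric) :
    ∃ (ι : Type u) (b : HilbertBasis ι ℂ H) (l : ι → ℂ), ∀ i, A (b i) = l i • b i := by
  have hcomp : ∀ μ : ℂ, CompleteSpace (Module.End.eigenspace (A : Module.End ℂ H) μ) := fun μ => by
    have : IsClosed (Module.End.eigenspace (A : Module.End ℂ H) μ : Set H) := by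
      have h1 : (Module.End.eigenspace (A : Module.End ℂ H) μ : Set H) = {x | A x = μ • x} := by
        ext x
        simp
      rw [h1]
      exact isClosed_eq (by fun_prop) (by fun_prop)
    exact this.completeSpace_coe
  -- Hilbert bases of all eigenspaces are put together, including the kernel μ = 0; for μ that is
  -- not an eigenvalue the basis is empty.
  choose w b hb using fun μ : ℂ =>
    exists_hilbertBasis ℂ (Module.End.eigenspace (A : Module.End ℂ H) μ)
  have hon := hA'.orthogonalFamily_eigenspaces.orthonormal_sigma_orthonormal
    (v_family := fun μ => b μ) fun μ => (b μ).orthonormal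
  refine ⟨Σ μ : ℂ, w μ, HilbertBasis.mkOfOrthogonalEqBot hon ?_, fun i => i.1, fun i => ?_⟩
  · rw [eq_bot_iff, ← ContinuousLinearMap.orthogonalComplement_iSup_eigenspaces_eq_bot hA hA',
      ← Submodule.iInf_orthogonal]
    intro x hx
    rw [Submodule.mem_iInf]
    intro μ
    rw [Submodule.mem_orthogonal']
    intro v hv
    have h1 := ((b μ).hasSum_repr ⟨v, hv⟩).mapL
      ((innerSL ℂ x) ∘L (Module.End.eigenspace (A : Module.End ℂ H) μ).subtypeL)
    refine h1.unique ?_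
    convert! hasSum_zero with i
    have h2 := (Submodule.mem_orthogonal' _ _).1 hx _
      (Submodule.subset_span ⟨(⟨μ, i⟩ : Σ μ : ℂ, w μ), rfl⟩)
    simpa using .inr h2
  · rw [HilbertBasis.coe_mkOfOrthogonalEqBot]
    exact Module.End.mem_eigenspace_iff.1 (b i.1 i.2).2

/-- An operator `T` for which `∑ ‖T e_i‖ ^ p` is bounded over all finite orthonormal families
belongs to the Schatten class `S_p`. -/
theorem memSchatten_of_sum_norm_rpow_le [CompleteSpace H] {T : H →L[ℂ] H} {p M : ℝ} (hp : 0 < p)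
    (hM : ∀ (n : ℕ) (e : Fin n → H), Orthonormal ℂ e → ∑ i, ‖T (e i)‖ ^ p ≤ M) :
    MemSchatten p T := by
  have hsymm : (ContinuousLinearMap.adjoint T ∘L T).IsSymmetric := fun x y => by
    simp [ContinuousLinearMap.adjoint_inner_left, ContinuousLinearMap.adjoint_inner_right]
  obtain ⟨ι, b, l, hl⟩ := exists_hilbertBasis_eigenvectors
    ((isCompactOperator_of_sum_norm_rpow_le hp hM).clm_comp (ContinuousLinearMap.adjoint T)) hsymm
  -- An eigenbasis b of T*T is sent by T to mutually orthogonal vectors. So the ‖T b_i‖ are the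
  -- singular values, and the normalised nonzero T b_i are the left singular vectors.
  have horth : ∀ i j, i ≠ j → inner ℂ (T (b i)) (T (b j)) = 0 := fun i j hij => by
    rw [← ContinuousLinearMap.adjoint_inner_left]
    have := hl i
    rw [ContinuousLinearMap.comp_apply] at this
    rw [this, inner_smul_left, b.orthonormal.2 hij, mul_zero]
  set J := {i : ι // 0 < ‖T (b i)‖}
  set s₀ : J → ℝ := fun j => ‖T (b j)‖ with hs₀
  set σ₀ : J → H := fun j => ((s₀ j : ℂ))⁻¹ • T (b j) with hσ₀
  have hs₀pos : ∀ j, 0 < s₀ j := fun j => j.2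
  have hbJ : Orthonormal ℂ fun j : J => b j := b.orthonormal.comp _ Subtype.val_injective
  have hσJ : Orthonormal ℂ σ₀ := by
    refine ⟨fun j => ?_, fun i j hij => ?_⟩
    · rw [hσ₀, norm_smul, norm_inv, Complex.norm_real, norm_norm]
      exact inv_mul_cancel₀ (hs₀pos j).ne'
    · simp only [hσ₀]
      rw [inner_smul_left, inner_smul_right,
        horth i j (fun h => hij (Subtype.ext h)), mul_zero, mul_zero]
  obtain ⟨f, hf, hfs, hfr⟩ := exists_decreasing_enumeration hs₀pos
    (fun ε hε => finite_setOf_le_norm_of_orthonormal hp hM hbJ hε)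
  have hsum : Summable fun j => s₀ j ^ p :=
    summable_of_sum_le (fun j => by positivity) fun t =>
      sum_norm_rpow_le_of_orthonormal hM hbJ t
  -- Extension by zero covers finite rank. The range of f is an initial segment of ℕ, so s stays
  -- decreasing.
  set s := Function.extend f s₀ 0 with hs
  set e := Function.extend f (fun j : J => b j) 0 with he
  set σ := Function.extend f σ₀ 0 with hσ
  have hsf : ∀ j, s (f j) = s₀ j := fun j => hf.extend_apply _ _ _
  have hef : ∀ j, e (f j) = b j := fun j => hf.extend_apply _ _ _
  have hσf : ∀ j, σ (f j) = σ₀ j := fun j => hf.extend_apply _ _ _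
  have hs0 : ∀ n, n ∉ Set.range f → s n = 0 := fun n hn => by
    rw [hs, Function.extend_apply' _ _ _ hn, Pi.zero_apply]
  have hsnn : ∀ n, 0 ≤ s n := fun n => by
    by_cases hn : n ∈ Set.range f
    · obtain ⟨j, rfl⟩ := hn
      rw [hsf]
      exact (hs₀pos j).le
    · rw [hs0 n hn]
  have hrange : ∀ n : {n // s n ≠ 0}, ∃ j, f j = n := fun n => by
    by_contra h
    exact n.2 (hs0 n h)
  choose k hk using hrange
  have hkinj : Function.Injective k := fun n n' hnn => by
    rw [Subtype.ext_iff, ← hk n, ← hk n', hnn]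
  have hsums : Summable fun n => s n ^ p := by
    rw [← hf.summable_iff]
    · simpa only [Function.comp_def, hsf] using hsum
    · intro n hn
      rw [hs0 n hn, Real.zero_rpow hp.ne']
  refine ⟨s, e, σ, fun n n' hn => ?_, hsnn, ?_, ?_, ?_, fun x => ?_, hsums⟩
  · by_cases hn' : n' ∈ Set.range f
    · obtain ⟨j, rfl⟩ := hn'
      obtain ⟨i, rfl⟩ : ∃ i, f i = n := by
        rcases hn.eq_or_lt with h | h
        · exact ⟨j, h.symm⟩
        · exact hfr j n h
      rw [hsf, hsf]
      by_contra! h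
      exact absurd (hfs _ _ h) (not_lt.2 hn)
    · rw [hs0 n' hn']
      exact hsnn n
  · have h1 := (hsums.tendsto_atTop_zero).rpow_const (p := p⁻¹) (.inr (by positivity))
    rw [Real.zero_rpow (by positivity)] at h1
    refine h1.congr fun n => ?_
    rw [← Real.rpow_mul (hsnn n), mul_inv_cancel₀ hp.ne', Real.rpow_one]
  · have : (fun n : {n // s n ≠ 0} => e n) = fun n => b (k n) := by
      ext1 n
      rw [← hef, hk]
    rw [this]
    exact hbJ.comp k hkinj
  · have : (fun n : {n // s n ≠ 0} => σ n) = fun n => σ₀ (k n) := by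
      ext1 n
      rw [← hσf, hk]
    rw [this]
    exact hσJ.comp k hkinj
  · rw [← hf.hasSum_iff]
    · have h1 := (b.hasSum_repr x).mapL T
      have h2 : Function.support (fun i => T (b.repr x i • b i)) ⊆ {i | 0 < ‖T (b i)‖} := by
        intro i hi
        rw [Function.mem_support, map_smul] at hi
        exact norm_pos_iff.2 (smul_ne_zero_iff.1 hi).2
      rw [← hasSum_subtype_iff_of_support_subset h2] at h1
      convert! h1 using 1
      ext1 j
      simp only [Function.comp_apply, hsf, hef, hσf, hσ₀, map_smul, HilbertBasis.repr_apply_apply]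
      rw [smul_smul]
      congr 1
      have : (s₀ j : ℂ) ≠ 0 := Complex.ofReal_ne_zero.2 (hs₀pos j).ne'
      field_simp
    · intro n hn
      simp [hs0 n hn]

end Hilbert

/-! ### The Volterra operator with affine symbol along a segment -/

section Volterra

variable (a b : ℂ)

lemma volterra_affine (F : ℂ → ℂ) (z : ℂ) :
    volterra (fun z => a * z + b) F z = ∫ t in (0 : ℝ)..1, F (t * z) * a * z := by
  have : ∀ x, deriv (fun z : ℂ => a * z + b) x = a := fun x => by simp
  simp only [volterra, this]

lemma volterra_affine_eq_sub {F P : ℂ → ℂ} (hF : Continuous F) (hP : ∀ z, HasDerivAt P (F z) z)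
    (z : ℂ) : volterra (fun z => a * z + b) F z = a * (P z - P 0) := by
  have h1 : ∀ t : ℝ, HasDerivAt (fun t : ℝ => a * P (t * z)) (F (t * z) * a * z) t := fun t => by
    have h2 : HasDerivAt (fun t : ℝ => (t : ℂ) * z) z t := by
      simpa using (Complex.ofRealCLM.hasDerivAt (x := t)).mul_const z
    have h3 := ((hP (t * z)).comp_of_eq t h2 rfl).const_mul a
    convert! h3 using 1
    ring
  rw [volterra_affine, intervalIntegral.integral_eq_sub_of_hasDerivAt (fun t _ => h1 t)
    (Continuous.intervalIntegrable (by fun_prop) _ _)]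
  simp [mul_sub]

lemma differentiable_volterra_affine {F : ℂ → ℂ} (hF : Differentiable ℂ F) :
    Differentiable ℂ (volterra (fun z => a * z + b) F) := by
  obtain ⟨P, hP⟩ := hF.isExactOn_univ
  have hP' : ∀ z, HasDerivAt P (F z) z := fun z => hP z (Set.mem_univ z)
  have hPd : Differentiable ℂ P := fun z => (hP' z).differentiableAt
  rw [funext fun z => volterra_affine_eq_sub a b hF.continuous hP' z]
  fun_prop

lemma volterra_affine_add {F G : ℂ → ℂ} (hF : Continuous F) (hG : Continuous G) :
    volterra (fun z => a * z + b) (F + G) =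
      volterra (fun z => a * z + b) F + volterra (fun z => a * z + b) G := by
  ext z
  rw [Pi.add_apply, volterra_affine, volterra_affine, volterra_affine,
    ← intervalIntegral.integral_add (Continuous.intervalIntegrable (by fun_prop) _ _)
      (Continuous.intervalIntegrable (by fun_prop) _ _)]
  refine intervalIntegral.integral_congr fun t _ => ?_
  simp only [Pi.add_apply]
  ring

lemma volterra_affine_smul (c : ℂ) (F : ℂ → ℂ) :
    volterra (fun z => a * z + b) (c • F) = c • volterra (fun z => a * z + b) F := by
  ext z
  rw [Pi.smul_apply, volterra_affine, volterra_affine, ← intervalIntegral.integral_smul]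
  refine intervalIntegral.integral_congr fun t _ => ?_
  simp only [Pi.smul_apply, smul_eq_mul]
  ring

/-- The integral is at most 1 and at most 1/(βx²). This decay is the source of the gain in the
Volterra operator. -/
lemma integral_exp_neg_mul_one_sub_le {β : ℝ} (hβ : 0 < β) (x : ℝ) :
    (∫ t in (0 : ℝ)..1, Real.exp (-(β * x ^ 2) * (1 - t))) * (1 + 2 * x ^ 2) ≤ 1 + 2 / β := by
  set I := ∫ t in (0 : ℝ)..1, Real.exp (-(β * x ^ 2) * (1 - t)) with hI
  have hint : IntervalIntegrable (fun t => Real.exp (-(β * x ^ 2) * (1 - t))) volume 0 1 :=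
    Continuous.intervalIntegrable (by fun_prop) _ _
  have h1 : I ≤ 1 := by
    calc I ≤ ∫ _ in (0 : ℝ)..1, (1 : ℝ) := by
          refine intervalIntegral.integral_mono_on zero_le_one hint
            (by simp) fun t ht => ?_
          rw [Real.exp_le_one_iff, neg_mul, neg_nonpos]
          have : 0 ≤ 1 - t := by linarith [ht.2]
          positivity
      _ = 1 := by simp
  have h2 : I * (β * x ^ 2) ≤ 1 := by
    have hd : ∀ t : ℝ, HasDerivAt (fun t => Real.exp (-(β * x ^ 2) * (1 - t)))
        (Real.exp (-(β * x ^ 2) * (1 - t)) * (β * x ^ 2)) t := fun t => by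
      have := ((((hasDerivAt_id t).const_sub 1).const_mul (-(β * x ^ 2)))).exp
      convert! this using 1
      simp only [id]
      ring
    rw [hI, ← intervalIntegral.integral_mul_const,
      intervalIntegral.integral_eq_sub_of_hasDerivAt (fun t _ => hd t) (hint.mul_const _)]
    have := Real.exp_pos (-(β * x ^ 2) * (1 - 0))
    simp only [sub_self, mul_zero, Real.exp_zero]
    linarith
  have h3 : I * x ^ 2 ≤ 1 / β := by
    rw [le_div_iff₀ hβ]
    linarith
  calc I * (1 + 2 * x ^ 2) = I + 2 * (I * x ^ 2) := by ring
    _ ≤ 1 + 2 * (1 / β) := by linarith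
    _ = _ := by ring

/-- A bound for the Volterra operator at `z`, given bounds along the segment from `0` to `z`. The
Gaussian weight yields the gain `(1 + |z|)⁻¹`. -/
lemma exists_norm_volterra_affine_sq_le {α : ℝ} (hα : 0 < α) (c : ℝ) :
    ∃ K : ℝ, 0 ≤ K ∧ ∀ F : ℂ → ℂ, Continuous F → ∀ (z : ℂ) (y : ℝ), 0 ≤ y →
      (∀ t ∈ Set.Icc (0 : ℝ) 1, Real.exp (-α * ‖t * z‖ ^ 2) * ‖F (t * z)‖ ^ 2 ≤
        Real.exp (c * ((1 - t) * ‖z‖)) * y) →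
      Real.exp (-α * ‖z‖ ^ 2) * ‖volterra (fun z => a * z + b) F z‖ ^ 2 ≤
        K * ((1 + ‖z‖) ^ 2)⁻¹ * y := by
  -- Passing from z to tz gains α(1 - t²)x² ≥ α(1 - t)x² in the exponent for ‖F‖². Half of this
  -- absorbs c(1 - t)x up to 2κ, by completing the square. The other half, after the square root,
  -- leaves β = α/4.
  set β := α / 4 with hβ
  have hβ0 : 0 < β := by positivity
  set κ := c ^ 2 / (4 * α) with hκ
  refine ⟨(‖a‖ * Real.exp κ * (1 + 2 / β)) ^ 2, by positivity, fun F hF z y hy h => ?_⟩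
  set x := ‖z‖ with hx
  have hx0 : 0 ≤ x := norm_nonneg z
  set D := Real.sqrt y * Real.exp (α * x ^ 2 / 2) * Real.exp κ * ‖a‖ with hD
  have hpt : ∀ t ∈ Set.Icc (0 : ℝ) 1, ‖F (t * z) * a * z‖ ≤
      D * x * Real.exp (-(β * x ^ 2) * (1 - t)) := by
    intro t ht
    have h1 : ‖F (t * z)‖ ≤ Real.sqrt y * Real.exp (α * x ^ 2 / 2) * Real.exp κ *
        Real.exp (-(β * x ^ 2) * (1 - t)) := by
      refine le_of_sq_le_sq ?_ (by positivity)
      have h2 := h t ht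
      rw [← le_div_iff₀' (Real.exp_pos _), div_eq_mul_inv, ← Real.exp_neg] at h2
      have h3 : ‖(t : ℂ) * z‖ = t * x := by
        rw [norm_mul, Complex.norm_real, Real.norm_of_nonneg ht.1]
      rw [h3] at h2
      have ht1 : 0 ≤ 1 - t := by linarith [ht.2]
      have h4 : c * x ≤ α * x ^ 2 / 2 + 2 * κ := by
        rw [hκ]
        have : 0 ≤ (α * x - c) ^ 2 / (2 * α) := by positivity
        have h5 : (α * x - c) ^ 2 / (2 * α) = α * x ^ 2 / 2 - c * x + 2 * (c ^ 2 / (4 * α)) := by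
          field_simp
          ring
        linarith
      have h6 : 0 ≤ κ := by positivity
      have h7 : (1 - t) * (c * x) ≤ (1 - t) * (α * x ^ 2 / 2 + 2 * κ) := by gcongr
      have h8 : 0 ≤ t * (1 - t) * (α * x ^ 2) := by
        have := ht.1
        positivity
      have h9 : 0 ≤ t * κ := mul_nonneg ht.1 h6
      set E := α * x ^ 2 / 2 + κ + -(β * x ^ 2) * (1 - t) with hE
      calc ‖F (t * z)‖ ^ 2 ≤ y * Real.exp (c * ((1 - t) * x) + α * (t * x) ^ 2) := by
            refine h2.trans (le_of_eq ?_)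
            rw [Real.exp_add]
            ring_nf
        _ ≤ y * Real.exp (E + E) := by
            refine mul_le_mul_of_nonneg_left (Real.exp_le_exp.2 ?_) hy
            rw [hE, hβ]
            nlinarith
        _ = _ := by
            rw [Real.exp_add, hE, Real.exp_add, Real.exp_add]
            simp only [mul_pow, Real.sq_sqrt hy]
            ring
    calc ‖F (t * z) * a * z‖ = ‖F (t * z)‖ * ‖a‖ * x := by rw [norm_mul, norm_mul]
      _ ≤ (Real.sqrt y * Real.exp (α * x ^ 2 / 2) * Real.exp κ *
        Real.exp (-(β * x ^ 2) * (1 - t))) * ‖a‖ * x := by gcongr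
      _ = _ := by rw [hD]; ring
  set I := ∫ t in (0 : ℝ)..1, Real.exp (-(β * x ^ 2) * (1 - t)) with hI
  have hI0 : 0 ≤ I := intervalIntegral.integral_nonneg zero_le_one fun t _ => (Real.exp_pos _).le
  have h1 : ‖volterra (fun z => a * z + b) F z‖ ≤ D * x * I := by
    rw [volterra_affine, hI, ← intervalIntegral.integral_const_mul]
    refine intervalIntegral.norm_integral_le_of_norm_le zero_le_one
      (.of_forall fun t ht => hpt t (Set.Ioc_subset_Icc_self ht))
      (Continuous.intervalIntegrable (by fun_prop) _ _)
  have h2 : ‖volterra (fun z => a * z + b) F z‖ * (1 + x) ≤ D * (1 + 2 / β) := by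
    calc ‖volterra (fun z => a * z + b) F z‖ * (1 + x) ≤ D * x * I * (1 + x) := by gcongr
      _ = D * (I * (x * (1 + x))) := by ring
      _ ≤ D * (I * (1 + 2 * x ^ 2)) := by
        gcongr
        nlinarith [sq_nonneg (x - 1)]
      _ ≤ _ := by
        gcongr
        exact integral_exp_neg_mul_one_sub_le hβ0 x
  have h3 : ‖volterra (fun z => a * z + b) F z‖ ^ 2 * (1 + x) ^ 2 ≤ D ^ 2 * (1 + 2 / β) ^ 2 := by
    rw [← mul_pow, ← mul_pow]
    gcongr
  have h4 : D ^ 2 = y * Real.exp (α * x ^ 2) * Real.exp κ ^ 2 * ‖a‖ ^ 2 := by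
    rw [hD, mul_pow, mul_pow, mul_pow, Real.sq_sqrt hy, ← Real.exp_nat_mul (α * x ^ 2 / 2)]
    congr 4
    push_cast
    ring
  rw [h4] at h3
  have h5 : Real.exp (-α * x ^ 2) * Real.exp (α * x ^ 2) = 1 := by
    rw [← Real.exp_add]
    simp
  rw [mul_right_comm, ← div_eq_mul_inv, le_div_iff₀ (by positivity)]
  calc Real.exp (-α * x ^ 2) * ‖volterra (fun z => a * z + b) F z‖ ^ 2 * (1 + x) ^ 2
      = Real.exp (-α * x ^ 2) * (‖volterra (fun z => a * z + b) F z‖ ^ 2 * (1 + x) ^ 2) := by ring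
    _ ≤ Real.exp (-α * x ^ 2) *
        (y * Real.exp (α * x ^ 2) * Real.exp κ ^ 2 * ‖a‖ ^ 2 * (1 + 2 / β) ^ 2) := by gcongr
    _ = (Real.exp (-α * x ^ 2) * Real.exp (α * x ^ 2)) *
        (y * Real.exp κ ^ 2 * ‖a‖ ^ 2 * (1 + 2 / β) ^ 2) := by ring
    _ = _ := by rw [h5]; ring

end Volterra

/-! ### The Littlewood–Paley type estimate -/

section

variable {m : Measure ℂ} {δ : ℝ} {N : ℕ} {C : ℝ≥0∞}

/-- The mean value estimate at ζ is recentred at z. Replacing W(ζ) by W(z), and the integral over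
D(ζ, δ) by one smoothed around z, costs only exponentials in ‖z - ζ‖. One quantity attached to z
thus controls F on the whole segment from 0 to z. -/
lemma RestrictedDoubling.exists_gaussSq_mul_measure_le_lintegral_exp
    (h : RestrictedDoubling m δ N C) {α : ℝ} (hα : 0 < α) :
    ∃ (B : ℝ≥0∞) (c : ℝ), B ≠ ∞ ∧ ∀ F : ℂ → ℂ, Differentiable ℂ F → ∀ z ζ,
      gaussSq α F ζ * m (Metric.closedBall z δ) ≤ B * ENNReal.ofReal (Real.exp (c * ‖z - ζ‖)) *
        ∫⁻ ξ, ENNReal.ofReal (Real.exp (-‖z - ξ‖)) * gaussSq α F ξ ∂m := by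
  obtain ⟨B, hB, hle⟩ := h.exists_gaussSq_mul_measure_le α hα
  obtain ⟨A, c, hA, hc, hW⟩ := h.exists_growth
  refine ⟨B * ENNReal.ofReal (A * Real.exp δ), c + 1, by finiteness, fun F hF z ζ => ?_⟩
  set Φ := ∫⁻ ξ, ENNReal.ofReal (Real.exp (-‖z - ξ‖)) * gaussSq α F ξ ∂m with hΦ
  have h1 : ∫⁻ ξ in Metric.closedBall ζ δ, gaussSq α F ξ ∂m ≤
      ENNReal.ofReal (Real.exp (‖z - ζ‖ + δ)) * Φ := by
    calc ∫⁻ ξ in Metric.closedBall ζ δ, gaussSq α F ξ ∂m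
        ≤ ∫⁻ ξ in Metric.closedBall ζ δ, ENNReal.ofReal (Real.exp (‖z - ζ‖ + δ)) *
          (ENNReal.ofReal (Real.exp (-‖z - ξ‖)) * gaussSq α F ξ) ∂m := by
          refine setLIntegral_mono' measurableSet_closedBall fun ξ hξ => ?_
          rw [← mul_assoc, ← ENNReal.ofReal_mul (Real.exp_pos _).le, ← Real.exp_add]
          refine le_mul_of_one_le_left' ?_
          rw [ENNReal.one_le_ofReal, Real.one_le_exp_iff]
          rw [Metric.mem_closedBall', dist_eq_norm] at hξ
          linarith [norm_sub_le_norm_sub_add_norm_sub z ζ ξ]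
      _ ≤ ∫⁻ ξ, ENNReal.ofReal (Real.exp (‖z - ζ‖ + δ)) *
          (ENNReal.ofReal (Real.exp (-‖z - ξ‖)) * gaussSq α F ξ) ∂m := setLIntegral_le_lintegral _ _
      _ = _ := lintegral_const_mul' _ _ ENNReal.ofReal_ne_top
  calc gaussSq α F ζ * m (Metric.closedBall z δ)
      ≤ gaussSq α F ζ * (ENNReal.ofReal (A * Real.exp (c * dist ζ z)) *
        m (Metric.closedBall ζ δ)) := by
        gcongr
        exact hW ζ z
    _ = ENNReal.ofReal (A * Real.exp (c * dist ζ z)) *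
        (gaussSq α F ζ * m (Metric.closedBall ζ δ)) := by ring
    _ ≤ ENNReal.ofReal (A * Real.exp (c * dist ζ z)) *
        (B * (ENNReal.ofReal (Real.exp (‖z - ζ‖ + δ)) * Φ)) := by
        gcongr ?_ * ?_
        · exact le_rfl
        · exact (hle F hF ζ).trans (by gcongr)
    _ = B * (ENNReal.ofReal (A * Real.exp (c * dist ζ z)) *
        ENNReal.ofReal (Real.exp (‖z - ζ‖ + δ))) * Φ := by ring
    _ = B * (ENNReal.ofReal (A * Real.exp δ) *
        ENNReal.ofReal (Real.exp ((c + 1) * ‖z - ζ‖))) * Φ := by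
        rw [← ENNReal.ofReal_mul (by positivity), ← ENNReal.ofReal_mul (by positivity),
          dist_comm, dist_eq_norm, mul_assoc A, mul_assoc A, ← Real.exp_add, ← Real.exp_add]
        congr 5
        ring
    _ = _ := by ring

/-- The pointwise estimate for the Volterra operator with affine symbol. -/
lemma RestrictedDoubling.exists_gaussSq_volterra_le (h : RestrictedDoubling m δ N C) {α : ℝ}
    (hα : 0 < α) (a b : ℂ) :
    ∃ K : ℝ≥0∞, K ≠ ∞ ∧ ∀ F : ℂ → ℂ, Differentiable ℂ F → ∫⁻ ξ, gaussSq α F ξ ∂m ≠ ∞ → ∀ z,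
      gaussSq α (volterra (fun z => a * z + b) F) z ≤
        K * (ENNReal.ofReal ((1 + ‖z‖) ^ 2)⁻¹ / m (Metric.closedBall z δ) *
          ∫⁻ ξ, ENNReal.ofReal (Real.exp (-‖z - ξ‖)) * gaussSq α F ξ ∂m) := by
  obtain ⟨B, c, hB, hle⟩ := h.exists_gaussSq_mul_measure_le_lintegral_exp hα
  obtain ⟨K, hK, hv⟩ := exists_norm_volterra_affine_sq_le a b hα c
  refine ⟨ENNReal.ofReal K * B, by finiteness, fun F hF hfin z => ?_⟩
  set Φ := ∫⁻ ξ, ENNReal.ofReal (Real.exp (-‖z - ξ‖)) * gaussSq α F ξ ∂m with hΦ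
  have hΦt : Φ ≠ ∞ := by
    refine ne_top_of_le_ne_top hfin (lintegral_mono fun ξ => mul_le_of_le_one_left' ?_)
    rw [← ENNReal.ofReal_one]
    gcongr
    rw [Real.exp_le_one_iff]
    simp
  set Y := B * Φ / m (Metric.closedBall z δ) with hY
  have hYt : Y ≠ ∞ := ENNReal.div_ne_top (by finiteness) (h.ne_zero z)
  have h1 := hv F hF.continuous z Y.toReal ENNReal.toReal_nonneg fun t ht => by
    rw [← ENNReal.ofReal_le_ofReal_iff (by positivity), ← gaussSq_eq_ofReal,
      ENNReal.ofReal_mul (by positivity), ENNReal.ofReal_toReal hYt, hY, ← mul_div_assoc,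
      ENNReal.le_div_iff_mul_le (.inl (h.ne_zero z)) (.inl (h.ne_top z))]
    refine (hle F hF z (t * z)).trans (le_of_eq ?_)
    have : ‖z - t * z‖ = (1 - t) * ‖z‖ := by
      have h2 : z - t * z = ((1 - t : ℝ) : ℂ) * z := by
        push_cast
        ring
      rw [h2, norm_mul, Complex.norm_real, Real.norm_of_nonneg (by linarith [ht.2])]
    rw [this]
    ring
  rw [gaussSq_eq_ofReal]
  refine (ENNReal.ofReal_le_ofReal h1).trans (le_of_eq ?_)
  rw [ENNReal.ofReal_mul (by positivity), ENNReal.ofReal_mul hK, ENNReal.ofReal_toReal hYt, hY]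
  simp only [div_eq_mul_inv]
  ring

/-- Half of the exponential decay pays for moving the weight from z to ξ, since 1 + ‖ξ‖ ≤ (1 +
‖z‖)(1 + d) and 1 + d ≤ 4 e^{d/4}. -/
lemma inv_one_add_sq_mul_exp_le (z ξ : ℂ) :
    ((1 + ‖z‖) ^ 2)⁻¹ * Real.exp (-‖z - ξ‖) ≤
      16 * ((1 + ‖ξ‖) ^ 2)⁻¹ * Real.exp (-(1 / 2) * ‖z - ξ‖) := by
  set d := ‖z - ξ‖
  have hd : 0 ≤ d := norm_nonneg _
  have h1 : 1 + ‖ξ‖ ≤ (1 + ‖z‖) * (1 + d) := by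
    have : ‖ξ‖ ≤ ‖z‖ + d := norm_le_norm_add_norm_sub z ξ
    nlinarith [norm_nonneg z]
  have h2 : (1 + d) ^ 2 ≤ 16 * Real.exp (1 / 2 * d) := by
    have h3 : 1 + d ≤ 4 * Real.exp (d / 4) := by
      have := Real.add_one_le_exp (d / 4)
      linarith
    calc (1 + d) ^ 2 ≤ (4 * Real.exp (d / 4)) ^ 2 := by gcongr
      _ = _ := by
        rw [mul_pow, ← Real.exp_nat_mul]
        norm_num
        ring
  have h4 : (1 + ‖ξ‖) ^ 2 ≤ (1 + ‖z‖) ^ 2 * (16 * Real.exp (1 / 2 * d)) :=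
    calc (1 + ‖ξ‖) ^ 2 ≤ ((1 + ‖z‖) * (1 + d)) ^ 2 := by gcongr
      _ = (1 + ‖z‖) ^ 2 * (1 + d) ^ 2 := by ring
      _ ≤ _ := by gcongr
  have h5 : Real.exp (-(1 / 2) * d) = Real.exp (1 / 2 * d) * Real.exp (-d) := by
    rw [← Real.exp_add]
    congr 1
    ring
  rw [h5, ← mul_assoc]
  gcongr
  rw [← div_eq_mul_inv, div_mul_eq_mul_div, inv_le_comm₀ (by positivity) (by positivity), inv_div,
    div_le_iff₀ (by positivity)]
  linarith

variable [SFinite m]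

/-- The Littlewood–Paley type estimate: the norm of the Volterra operator with affine symbol is
controlled by the norm with the additional factor `(1 + |z|)⁻²`. -/
theorem RestrictedDoubling.exists_lintegral_gaussSq_volterra_le (h : RestrictedDoubling m δ N C)
    {α : ℝ} (hα : 0 < α) (a b : ℂ) :
    ∃ K : ℝ≥0∞, K ≠ ∞ ∧ ∀ F : ℂ → ℂ, Differentiable ℂ F → ∫⁻ ξ, gaussSq α F ξ ∂m ≠ ∞ →
      ∫⁻ z, gaussSq α (volterra (fun z => a * z + b) F) z ∂m ≤
        K * ∫⁻ ξ, ENNReal.ofReal ((1 + ‖ξ‖) ^ 2)⁻¹ * gaussSq α F ξ ∂m := by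
  obtain ⟨K, hK, hle⟩ := h.exists_gaussSq_volterra_le hα a b
  obtain ⟨M, hM, hexp⟩ := h.exists_lintegral_exp_div_le (κ := 1 / 2) (by norm_num)
  refine ⟨K * (ENNReal.ofReal 16 * M), by finiteness, fun F hF hfin => ?_⟩
  have hW := measurable_measure_closedBall m δ
  have hgF := measurable_gaussSq α hF
  -- After Tonelli the z-integral is uniformly bounded, by the estimate for exponentials against
  -- dm/W with rate 1/2.
  have hinner : ∀ ξ, ∫⁻ z, ENNReal.ofReal ((1 + ‖z‖) ^ 2)⁻¹ / m (Metric.closedBall z δ) *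
      (ENNReal.ofReal (Real.exp (-‖z - ξ‖)) * gaussSq α F ξ) ∂m ≤
      ENNReal.ofReal 16 * M * (ENNReal.ofReal ((1 + ‖ξ‖) ^ 2)⁻¹ * gaussSq α F ξ) := by
    intro ξ
    calc ∫⁻ z, ENNReal.ofReal ((1 + ‖z‖) ^ 2)⁻¹ / m (Metric.closedBall z δ) *
          (ENNReal.ofReal (Real.exp (-‖z - ξ‖)) * gaussSq α F ξ) ∂m
        ≤ ∫⁻ z, ENNReal.ofReal (16 * ((1 + ‖ξ‖) ^ 2)⁻¹) * gaussSq α F ξ *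
          (ENNReal.ofReal (Real.exp (-(1 / 2) * ‖z - ξ‖)) / m (Metric.closedBall z δ)) ∂m := by
          refine lintegral_mono fun z => ?_
          calc ENNReal.ofReal ((1 + ‖z‖) ^ 2)⁻¹ / m (Metric.closedBall z δ) *
                (ENNReal.ofReal (Real.exp (-‖z - ξ‖)) * gaussSq α F ξ)
              = ENNReal.ofReal (((1 + ‖z‖) ^ 2)⁻¹ * Real.exp (-‖z - ξ‖)) * gaussSq α F ξ *
                (m (Metric.closedBall z δ))⁻¹ := by
                rw [ENNReal.ofReal_mul (by positivity), div_eq_mul_inv]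
                ring
            _ ≤ ENNReal.ofReal (16 * ((1 + ‖ξ‖) ^ 2)⁻¹ * Real.exp (-(1 / 2) * ‖z - ξ‖)) *
                gaussSq α F ξ * (m (Metric.closedBall z δ))⁻¹ := by
                gcongr ENNReal.ofReal ?_ * _ * _
                exact inv_one_add_sq_mul_exp_le z ξ
            _ = _ := by
                rw [ENNReal.ofReal_mul (by positivity)]
                simp only [div_eq_mul_inv]
                ring
      _ = ENNReal.ofReal (16 * ((1 + ‖ξ‖) ^ 2)⁻¹) * gaussSq α F ξ *
          ∫⁻ z, ENNReal.ofReal (Real.exp (-(1 / 2) * ‖z - ξ‖)) / m (Metric.closedBall z δ) ∂m :=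
          lintegral_const_mul _ (Measurable.div (by fun_prop) hW)
      _ ≤ ENNReal.ofReal (16 * ((1 + ‖ξ‖) ^ 2)⁻¹) * gaussSq α F ξ * M := by
          gcongr
          exact hexp ξ
      _ = _ := by
          rw [ENNReal.ofReal_mul (by positivity)]
          ring
  calc ∫⁻ z, gaussSq α (volterra (fun z => a * z + b) F) z ∂m
      ≤ ∫⁻ z, K * (ENNReal.ofReal ((1 + ‖z‖) ^ 2)⁻¹ / m (Metric.closedBall z δ) *
          ∫⁻ ξ, ENNReal.ofReal (Real.exp (-‖z - ξ‖)) * gaussSq α F ξ ∂m) ∂m :=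
        lintegral_mono fun z => hle F hF hfin z
    _ = K * ∫⁻ z, ∫⁻ ξ, ENNReal.ofReal ((1 + ‖z‖) ^ 2)⁻¹ / m (Metric.closedBall z δ) *
          (ENNReal.ofReal (Real.exp (-‖z - ξ‖)) * gaussSq α F ξ) ∂m ∂m := by
        rw [lintegral_const_mul' _ _ hK]
        congr 1
        refine lintegral_congr fun z => ?_
        rw [lintegral_const_mul _ (by fun_prop)]
    _ = K * ∫⁻ ξ, ∫⁻ z, ENNReal.ofReal ((1 + ‖z‖) ^ 2)⁻¹ / m (Metric.closedBall z δ) *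
          (ENNReal.ofReal (Real.exp (-‖z - ξ‖)) * gaussSq α F ξ) ∂m ∂m := by
        rw [lintegral_lintegral_swap]
        have h1 : Measurable fun z : ℂ =>
            ENNReal.ofReal ((1 + ‖z‖) ^ 2)⁻¹ / m (Metric.closedBall z δ) :=
          Measurable.div (by fun_prop) hW
        exact ((h1.comp measurable_fst).mul ((by fun_prop : Measurable fun p : ℂ × ℂ =>
          ENNReal.ofReal (Real.exp (-‖p.1 - p.2‖))).mul (hgF.comp measurable_snd))).aemeasurable
    _ ≤ K * ∫⁻ ξ, ENNReal.ofReal 16 * M *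
          (ENNReal.ofReal ((1 + ‖ξ‖) ^ 2)⁻¹ * gaussSq α F ξ) ∂m := by
        gcongr with ξ
        exact hinner ξ
    _ = _ := by
        rw [lintegral_const_mul' _ _ (by finiteness)]
        ring

end

/-! ### The weighted Fock space: entire representatives, point evaluations, completeness -/

/-- The measure `w dA`. -/
noncomputable abbrev weightMeasure (w : ℂ → ℝ) : Measure ℂ :=
  volume.withDensity fun z => ENNReal.ofReal (w z)

section FockSpace

variable {α : ℝ} {w : ℂ → ℝ}

lemma fockMeasure_eq_withDensity (hw : AEMeasurable w) (α : ℝ) :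
    fockMeasure α w = (weightMeasure w).withDensity
      fun z => ENNReal.ofReal (Real.exp (-α * ‖z‖ ^ 2)) := by
  rw [weightMeasure, ← withDensity_mul₀ hw.ennreal_ofReal (by fun_prop), fockMeasure]
  congr 1
  ext z
  rw [Pi.mul_apply, mul_comm, ENNReal.ofReal_mul' (Real.exp_pos _).le]

lemma lintegral_enorm_sq_fockMeasure (hw : AEMeasurable w) {F : ℂ → ℂ} (hF : Differentiable ℂ F) :
    ∫⁻ z, ‖F z‖ₑ ^ 2 ∂fockMeasure α w = ∫⁻ z, gaussSq α F z ∂weightMeasure w := by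
  have := hF.continuous.measurable
  rw [fockMeasure_eq_withDensity hw, lintegral_withDensity_eq_lintegral_mul _ (by fun_prop)
    (by fun_prop)]
  rfl

lemma enorm_sq_eq_lintegral_gaussSq (hw : AEMeasurable w) {f : Lp ℂ 2 (fockMeasure α w)}
    {F : ℂ → ℂ} (hF : Differentiable ℂ F) (hf : f =ᵐ[fockMeasure α w] F) :
    ‖f‖ₑ ^ 2 = ∫⁻ z, gaussSq α F z ∂weightMeasure w := by
  rw [Lp.enorm_def, eLpNorm_congr_ae hf,
    eLpNorm_eq_lintegral_rpow_enorm_toReal two_ne_zero ENNReal.ofNat_ne_top,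
    ← lintegral_enorm_sq_fockMeasure hw hF, ← ENNReal.rpow_natCast, ← ENNReal.rpow_mul]
  simp

lemma memLp_of_lintegral_gaussSq_ne_top (hw : AEMeasurable w) {F : ℂ → ℂ}
    (hF : Differentiable ℂ F) (hfin : ∫⁻ z, gaussSq α F z ∂weightMeasure w ≠ ∞) :
    MemLp F 2 (fockMeasure α w) := by
  refine ⟨hF.continuous.aestronglyMeasurable, ?_⟩
  rw [eLpNorm_lt_top_iff_lintegral_rpow_enorm_lt_top two_ne_zero ENNReal.ofNat_ne_top,
    lt_top_iff_ne_top]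
  rw [← lintegral_enorm_sq_fockMeasure hw hF] at hfin
  simpa using hfin

/-- The element of the Fock space given by an entire function of finite norm. -/
noncomputable def ofEntire (hw : AEMeasurable w) {F : ℂ → ℂ} (hF : Differentiable ℂ F)
    (hfin : ∫⁻ z, gaussSq α F z ∂weightMeasure w ≠ ∞) : fockSpace α w :=
  ⟨(memLp_of_lintegral_gaussSq_ne_top hw hF hfin).toLp F, F, hF, MemLp.coeFn_toLp _⟩

lemma coeFn_ofEntire (hw : AEMeasurable w) {F : ℂ → ℂ} (hF : Differentiable ℂ F)
    (hfin : ∫⁻ z, gaussSq α F z ∂weightMeasure w ≠ ∞) :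
    (ofEntire hw hF hfin : Lp ℂ 2 (fockMeasure α w)) =ᵐ[fockMeasure α w] F :=
  MemLp.coeFn_toLp (memLp_of_lintegral_gaussSq_ne_top hw hF hfin)

/-- The entire function representing an element of the Fock space. -/
noncomputable def entireRep (f : fockSpace α w) : ℂ → ℂ := f.2.choose

lemma differentiable_entireRep (f : fockSpace α w) : Differentiable ℂ (entireRep f) :=
  f.2.choose_spec.1

lemma ae_eq_entireRep (f : fockSpace α w) :
    (f : Lp ℂ 2 (fockMeasure α w)) =ᵐ[fockMeasure α w] entireRep f :=
  f.2.choose_spec.2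

lemma enorm_sq_eq_entireRep (hw : AEMeasurable w) (f : fockSpace α w) :
    ‖f‖ₑ ^ 2 = ∫⁻ z, gaussSq α (entireRep f) z ∂weightMeasure w :=
  enorm_sq_eq_lintegral_gaussSq hw (differentiable_entireRep f) (ae_eq_entireRep f)

lemma lintegral_gaussSq_entireRep_ne_top (hw : AEMeasurable w) (f : fockSpace α w) :
    ∫⁻ z, gaussSq α (entireRep f) z ∂weightMeasure w ≠ ∞ := by
  rw [← enorm_sq_eq_entireRep hw]
  finiteness

variable {δ : ℝ} {N : ℕ} {C : ℝ≥0∞}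

lemma RestrictedDoubling.exists_gaussSq_entireRep_le
    (h : RestrictedDoubling (weightMeasure w) δ N C) (hw : AEMeasurable w) (hα : 0 < α) :
    ∃ B : ℝ≥0∞, B ≠ ∞ ∧ ∀ (f : fockSpace α w) (z : ℂ),
      gaussSq α (entireRep f) z ≤ B / weightMeasure w (Metric.closedBall z δ) * ‖f‖ₑ ^ 2 := by
  obtain ⟨B, hB, hle⟩ := h.exists_gaussSq_mul_measure_le α hα
  refine ⟨B, hB, fun f z => ?_⟩
  rw [← ENNReal.mul_div_right_comm, ENNReal.le_div_iff_mul_le (.inl (h.ne_zero z))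
    (.inl (h.ne_top z)), enorm_sq_eq_entireRep hw]
  refine (hle _ (differentiable_entireRep f) z).trans ?_
  gcongr
  exact Measure.restrict_le_self

/-- The mean value estimate makes an entire function of norm zero vanish at every point. This makes
the chosen representative `entireRep` unique, hence linear in f. -/
lemma RestrictedDoubling.eq_of_ae_eq (h : RestrictedDoubling (weightMeasure w) δ N C)
    (hw : AEMeasurable w) (hα : 0 < α) {F G : ℂ → ℂ} (hF : Differentiable ℂ F)
    (hG : Differentiable ℂ G) (hFG : F =ᵐ[fockMeasure α w] G) : F = G := by
  obtain ⟨B, hB, hle⟩ := h.exists_gaussSq_mul_measure_le α hα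
  ext z
  have h0 : ∫⁻ ζ, gaussSq α (F - G) ζ ∂weightMeasure w = 0 := by
    rw [← lintegral_enorm_sq_fockMeasure hw (hF.sub hG), lintegral_eq_zero_iff'
      (by have := (hF.sub hG).continuous.measurable; fun_prop)]
    filter_upwards [hFG] with ζ hζ
    simp [hζ]
  have h1 := (hle _ (hF.sub hG) z).trans
    (mul_le_mul_right (setLIntegral_le_lintegral _ _) B)
  rw [h0, mul_zero, nonpos_iff_eq_zero, mul_eq_zero, or_iff_left (h.ne_zero z), gaussSq,
    mul_eq_zero, or_iff_right (by simp [Real.exp_pos])] at h1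
  simpa [sub_eq_zero] using h1

lemma RestrictedDoubling.entireRep_eq (h : RestrictedDoubling (weightMeasure w) δ N C)
    (hw : AEMeasurable w) (hα : 0 < α) {f : fockSpace α w} {F : ℂ → ℂ} (hF : Differentiable ℂ F)
    (hf : (f : Lp ℂ 2 (fockMeasure α w)) =ᵐ[fockMeasure α w] F) : entireRep f = F :=
  h.eq_of_ae_eq hw hα (differentiable_entireRep f) hF ((ae_eq_entireRep f).symm.trans hf)

lemma RestrictedDoubling.entireRep_add (h : RestrictedDoubling (weightMeasure w) δ N C)
    (hw : AEMeasurable w) (hα : 0 < α) (f g : fockSpace α w) :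
    entireRep (f + g) = entireRep f + entireRep g :=
  h.entireRep_eq hw hα ((differentiable_entireRep f).add (differentiable_entireRep g))
    ((Lp.coeFn_add _ _).trans ((ae_eq_entireRep f).add (ae_eq_entireRep g)))

lemma RestrictedDoubling.entireRep_smul (h : RestrictedDoubling (weightMeasure w) δ N C)
    (hw : AEMeasurable w) (hα : 0 < α) (c : ℂ) (f : fockSpace α w) :
    entireRep (c • f) = c • entireRep f :=
  h.entireRep_eq hw hα ((differentiable_entireRep f).const_smul c)
    ((Lp.coeFn_smul _ _).trans ((ae_eq_entireRep f).const_smul c))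

/-- Point evaluation on the Fock space, as a linear map. -/
noncomputable def RestrictedDoubling.evalₗ (h : RestrictedDoubling (weightMeasure w) δ N C)
    (hw : AEMeasurable w) (hα : 0 < α) (z : ℂ) : fockSpace α w →ₗ[ℂ] ℂ where
  toFun f := entireRep f z
  map_add' f g := by rw [h.entireRep_add hw hα, Pi.add_apply]
  map_smul' c f := by rw [h.entireRep_smul hw hα, Pi.smul_apply, RingHom.id_apply]

/-- Point evaluations are bounded, locally uniformly. -/
lemma RestrictedDoubling.exists_norm_entireRep_le
    (h : RestrictedDoubling (weightMeasure w) δ N C) (hw : AEMeasurable w) (hα : 0 < α) :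
    ∃ κ : ℂ → ℝ, Continuous κ ∧ ∀ (f : fockSpace α w) (z : ℂ),
      ‖entireRep f z‖ ≤ κ z * ‖f‖ := by
  obtain ⟨B, hB, hle⟩ := h.exists_gaussSq_entireRep_le hw hα
  obtain ⟨A, c, hA, hc, hW⟩ := h.exists_growth
  set W₀ := weightMeasure w (Metric.closedBall 0 δ) with hW₀
  set y := (B / W₀).toReal with hy
  refine ⟨fun z => Real.sqrt (A * Real.exp (c * ‖z‖) * y * Real.exp (α * ‖z‖ ^ 2)), by fun_prop,
    fun f z => ?_⟩
  have hB0 : B / W₀ ≠ ∞ := ENNReal.div_ne_top hB (h.ne_zero 0)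
  have h1 : gaussSq α (entireRep f) z ≤
      ENNReal.ofReal (A * Real.exp (c * ‖z‖) * y * ‖f‖ ^ 2) := by
    refine (hle f z).trans ?_
    rw [ENNReal.ofReal_mul (by positivity), ENNReal.ofReal_mul (by positivity),
      ENNReal.ofReal_toReal hB0, ENNReal.ofReal_pow (norm_nonneg _), ofReal_norm]
    gcongr
    rw [ENNReal.div_le_iff (h.ne_zero z) (h.ne_top z)]
    have h2 := hW z 0
    rw [dist_zero_right] at h2
    calc B = B / W₀ * W₀ := (ENNReal.div_mul_cancel (h.ne_zero 0) (h.ne_top 0)).symm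
      _ ≤ B / W₀ * (ENNReal.ofReal (A * Real.exp (c * ‖z‖)) *
          weightMeasure w (Metric.closedBall z δ)) := by gcongr
      _ = _ := by ring
  rw [gaussSq_eq_ofReal, ENNReal.ofReal_le_ofReal_iff (by positivity), ← le_div_iff₀'
    (Real.exp_pos _), div_eq_mul_inv, ← Real.exp_neg] at h1
  refine le_of_sq_le_sq ?_ (by positivity)
  rw [mul_pow, Real.sq_sqrt (by positivity)]
  refine h1.trans (le_of_eq ?_)
  rw [neg_mul, neg_neg]
  ring

/-- The weighted Fock space is complete. -/
lemma RestrictedDoubling.completeSpace_fockSpace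
    (h : RestrictedDoubling (weightMeasure w) δ N C) (hw : AEMeasurable w) (hα : 0 < α) :
    CompleteSpace (fockSpace α w) := by
  obtain ⟨κ, hκ, hle⟩ := h.exists_norm_entireRep_le hw hα
  refine IsClosed.completeSpace_coe (hs := IsSeqClosed.isClosed fun f g hf hfg => ?_)
  set φ : ℕ → fockSpace α w := fun n => ⟨f n, hf n⟩ with hφ
  have hdist : ∀ n k z, dist (entireRep (φ n) z) (entireRep (φ k) z) ≤
      κ z * dist (f n) (f k) := fun n k z => by
    have h1 := hle (φ n - φ k) z
    have h2 : entireRep (φ n - φ k) = entireRep (φ n) - entireRep (φ k) := by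
      rw [sub_eq_add_neg, ← neg_one_smul ℂ, h.entireRep_add hw hα, h.entireRep_smul hw hα,
        neg_one_smul, ← sub_eq_add_neg]
    rw [h2] at h1
    rw [dist_eq_norm, dist_eq_norm]
    exact h1
  have hcauchy := hfg.cauchySeq
  -- Norm bounds of evaluations are bounded on compact sets, so an L² Cauchy sequence is locally
  -- uniformly Cauchy and its pointwise limit is entire.
  have hunif : ∀ K : Set ℂ, IsCompact K →
      UniformCauchySeqOn (fun n => entireRep (φ n)) atTop K := by
    intro K hK
    obtain ⟨R, hR⟩ := hK.bddAbove_image hκ.continuousOn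
    have hR' : ∀ z ∈ K, κ z ≤ |R| + 1 := fun z hz =>
      (hR ⟨z, hz, rfl⟩).trans ((le_abs_self R).trans (by linarith))
    rw [Metric.uniformCauchySeqOn_iff]
    intro ε hε
    obtain ⟨n₀, hn₀⟩ := Metric.cauchySeq_iff.1 hcauchy (ε / (|R| + 1)) (by positivity)
    refine ⟨n₀, fun n hn k hk z hz => ?_⟩
    have h1 := hn₀ n hn k hk
    rw [lt_div_iff₀ (by positivity)] at h1
    calc dist (entireRep (φ n) z) (entireRep (φ k) z) ≤ κ z * dist (f n) (f k) := hdist n k z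
      _ ≤ (|R| + 1) * dist (f n) (f k) := by
        gcongr
        exact hR' z hz
      _ < ε := by linarith
  have hlim : ∀ z, ∃ y, Tendsto (fun n => entireRep (φ n) z) atTop (𝓝 y) := fun z =>
    cauchySeq_tendsto_of_complete
      ((hunif {z} isCompact_singleton).cauchySeq rfl)
  choose G hG using hlim
  have hGd : Differentiable ℂ G := by
    rw [← differentiableOn_univ]
    refine TendstoLocallyUniformlyOn.differentiableOn (φ := atTop)
      (F := fun n => entireRep (φ n)) ?_
      (.of_forall fun n => (differentiable_entireRep (φ n)).differentiableOn) isOpen_univ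
    rw [tendstoLocallyUniformlyOn_iff_forall_isCompact isOpen_univ]
    exact fun K _ hK => (hunif K hK).tendstoUniformlyOn_of_tendsto fun z _ => hG z
  refine ⟨G, hGd, ?_⟩
  -- An almost everywhere convergent subsequence identifies the L² limit with the entire limit G.
  obtain ⟨ns, hns, hae⟩ := (tendstoInMeasure_of_tendsto_Lp hfg).exists_seq_tendsto_ae
  have hall : ∀ᵐ z ∂fockMeasure α w, ∀ n, f n z = entireRep (φ n) z :=
    ae_all_iff.2 fun n => ae_eq_entireRep (φ n)
  filter_upwards [hae, hall] with z hz hz'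
  refine tendsto_nhds_unique hz ?_
  simp only [hz']
  exact (hG z).comp hns.tendsto_atTop

end FockSpace

/-! ### Boundedness of the Volterra operator -/

section Operator

variable {α : ℝ} {w : ℂ → ℝ} {δ : ℝ} {N : ℕ} {C : ℝ≥0∞}

lemma ofReal_inv_one_add_sq_le_one (z : ℂ) : ENNReal.ofReal ((1 + ‖z‖) ^ 2)⁻¹ ≤ 1 := by
  rw [← ENNReal.ofReal_one]
  gcongr
  exact inv_le_one_of_one_le₀ (one_le_pow₀ (by linarith [norm_nonneg z]))

/-- The Volterra operator with affine symbol is bounded on the weighted Fock space, with a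
Littlewood–Paley type bound for its norm. -/
theorem RestrictedDoubling.exists_volterraOperator
    (h : RestrictedDoubling (weightMeasure w) δ N C) (hw : AEMeasurable w) (hα : 0 < α)
    (a b : ℂ) :
    ∃ J : fockSpace α w →L[ℂ] fockSpace α w, IsVolterraOperator (fun z => a * z + b) J ∧
      ∃ K : ℝ≥0∞, K ≠ ∞ ∧ ∀ f : fockSpace α w, ‖J f‖ₑ ^ 2 ≤
        K * ∫⁻ z, ENNReal.ofReal ((1 + ‖z‖) ^ 2)⁻¹ * gaussSq α (entireRep f) z
          ∂weightMeasure w := by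
  obtain ⟨K, hK, hle⟩ := h.exists_lintegral_gaussSq_volterra_le hα a b
  set V : (ℂ → ℂ) → ℂ → ℂ := volterra (fun z => a * z + b) with hV
  have hVd : ∀ f : fockSpace α w, Differentiable ℂ (V (entireRep f)) := fun f =>
    differentiable_volterra_affine a b (differentiable_entireRep f)
  have hbound : ∀ f : fockSpace α w, ∫⁻ z, gaussSq α (V (entireRep f)) z ∂weightMeasure w ≤
      K * ∫⁻ z, ENNReal.ofReal ((1 + ‖z‖) ^ 2)⁻¹ * gaussSq α (entireRep f) z ∂weightMeasure w :=
    fun f => hle _ (differentiable_entireRep f) (lintegral_gaussSq_entireRep_ne_top hw f)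
  have hbound' : ∀ f : fockSpace α w, ∫⁻ z, gaussSq α (V (entireRep f)) z ∂weightMeasure w ≤
      K * ‖f‖ₑ ^ 2 := fun f => by
    refine (hbound f).trans ?_
    rw [enorm_sq_eq_entireRep hw]
    gcongr with z
    exact mul_le_of_le_one_left' (ofReal_inv_one_add_sq_le_one z)
  have hfin : ∀ f : fockSpace α w, ∫⁻ z, gaussSq α (V (entireRep f)) z ∂weightMeasure w ≠ ∞ :=
    fun f => ne_top_of_le_ne_top (by finiteness) (hbound' f)
  have hnorm : ∀ f : fockSpace α w, ‖ofEntire hw (hVd f) (hfin f)‖ₑ ^ 2 =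
      ∫⁻ z, gaussSq α (V (entireRep f)) z ∂weightMeasure w := fun f =>
    enorm_sq_eq_lintegral_gaussSq hw (hVd f) (coeFn_ofEntire hw (hVd f) (hfin f))
  set L : fockSpace α w →ₗ[ℂ] fockSpace α w :=
    { toFun := fun f => ofEntire hw (hVd f) (hfin f)
      map_add' := fun f g => by
        refine Subtype.ext (Lp.ext ?_)
        have h1 : V (entireRep (f + g)) = V (entireRep f) + V (entireRep g) := by
          rw [h.entireRep_add hw hα]
          exact volterra_affine_add a b (differentiable_entireRep f).continuous
            (differentiable_entireRep g).continuous
        refine (coeFn_ofEntire hw _ _).trans ?_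
        rw [h1]
        exact ((Lp.coeFn_add _ _).trans
          ((coeFn_ofEntire hw _ _).add (coeFn_ofEntire hw _ _))).symm
      map_smul' := fun c f => by
        refine Subtype.ext (Lp.ext ?_)
        have h1 : V (entireRep (c • f)) = c • V (entireRep f) := by
          rw [h.entireRep_smul hw hα]
          exact volterra_affine_smul a b c _
        refine (coeFn_ofEntire hw _ _).trans ?_
        rw [h1]
        exact ((Lp.coeFn_smul _ _).trans ((coeFn_ofEntire hw _ _).const_smul c)).symm } with hL
  have hLbound : ∀ f, ‖L f‖ ≤ Real.sqrt K.toReal * ‖f‖ := fun f => by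
    refine le_of_sq_le_sq ?_ (by positivity)
    rw [mul_pow, Real.sq_sqrt ENNReal.toReal_nonneg, ← ENNReal.ofReal_le_ofReal_iff
      (by positivity), ENNReal.ofReal_mul ENNReal.toReal_nonneg, ENNReal.ofReal_toReal hK,
      ENNReal.ofReal_pow (norm_nonneg _), ENNReal.ofReal_pow (norm_nonneg _), ofReal_norm,
      ofReal_norm]
    exact (hnorm f).trans_le (hbound' f)
  refine ⟨L.mkContinuous _ hLbound, fun f F hF hf => ?_, K, hK, fun f => ?_⟩
  · rw [← h.entireRep_eq hw hα hF hf]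
    exact coeFn_ofEntire hw (hVd f) (hfin f)
  · exact (hnorm f).trans_le (hbound f)

/-- Bessel's inequality for a bounded functional, in terms of a bound for its norm. -/
lemma sum_norm_sq_le_of_orthonormal {H : Type*} [NormedAddCommGroup H] [InnerProductSpace ℂ H]
    {L : H →ₗ[ℂ] ℂ} {y : ℝ} (hy : 0 ≤ y) (hL : ∀ f, ‖L f‖ ^ 2 ≤ y * ‖f‖ ^ 2) {κ : Type*} [Fintype κ]
    {e : κ → H} (he : Orthonormal ℂ e) : ∑ i, ‖L (e i)‖ ^ 2 ≤ y := by
  set S := ∑ i, ‖L (e i)‖ ^ 2 with hS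
  -- For this f both L f and ‖f‖² equal S, so the hypothesis reads S² ≤ y S.
  set f := ∑ i, starRingEnd ℂ (L (e i)) • e i with hf
  have hS0 : 0 ≤ S := by positivity
  have h1 : L f = S := by
    rw [hf, map_sum, hS]
    push_cast
    refine Finset.sum_congr rfl fun i _ => ?_
    rw [map_smul, smul_eq_mul, Complex.conj_mul']
  have h2 : ‖f‖ ^ 2 = S := by
    have h3 : inner ℂ f f = (S : ℂ) := by
      rw [hf, he.inner_sum, hS]
      push_cast
      refine Finset.sum_congr rfl fun i _ => ?_
      rw [Complex.conj_conj, Complex.mul_conj']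
    rw [← inner_self_eq_norm_sq (𝕜 := ℂ), h3]
    simp
  have h3 := hL f
  rw [h1, h2, Complex.norm_real, Real.norm_of_nonneg hS0] at h3
  rcases hS0.eq_or_lt with h0 | h0
  · rwa [← h0]
  · nlinarith

end Operator

/-! ### Membership in S_p for p > 2 -/

section SchattenUpper

variable {α : ℝ} {w : ℂ → ℝ} {δ : ℝ} {N : ℕ} {C : ℝ≥0∞}

/-- Bessel's inequality for point evaluation at z: the single-function bound B/W(z) holds for the
whole orthonormal sum, independently of n. -/
lemma RestrictedDoubling.exists_sum_gaussSq_le (h : RestrictedDoubling (weightMeasure w) δ N C)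
    (hw : AEMeasurable w) (hα : 0 < α) :
    ∃ B : ℝ≥0∞, B ≠ ∞ ∧ ∀ (n : ℕ) (e : Fin n → fockSpace α w), Orthonormal ℂ e → ∀ z,
      ∑ i, gaussSq α (entireRep (e i)) z ≤ B / weightMeasure w (Metric.closedBall z δ) := by
  obtain ⟨B, hB, hle⟩ := h.exists_gaussSq_entireRep_le hw hα
  refine ⟨B, hB, fun n e he z => ?_⟩
  set D := B / weightMeasure w (Metric.closedBall z δ) with hD
  have hDt : D ≠ ∞ := ENNReal.div_ne_top hB (h.ne_zero z)
  have h1 := sum_norm_sq_le_of_orthonormal (L := h.evalₗ hw hα z)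
    (y := D.toReal * Real.exp (α * ‖z‖ ^ 2)) (by positivity) (fun f => by
      have h2 := hle f z
      rw [gaussSq_eq_ofReal, ← hD, ← ENNReal.ofReal_toReal hDt, ← ofReal_norm, ← ENNReal.ofReal_pow
        (norm_nonneg _), ← ENNReal.ofReal_mul ENNReal.toReal_nonneg,
        ENNReal.ofReal_le_ofReal_iff (by positivity), ← le_div_iff₀' (Real.exp_pos _),
        div_eq_mul_inv, ← Real.exp_neg, neg_mul, neg_neg] at h2
      refine h2.trans (le_of_eq ?_)
      ring) he
  simp only [gaussSq_eq_ofReal]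
  rw [← ENNReal.ofReal_sum_of_nonneg (fun i _ => by positivity), ← Finset.mul_sum,
    ← ENNReal.ofReal_toReal hDt]
  refine ENNReal.ofReal_le_ofReal ?_
  rw [← le_div_iff₀' (Real.exp_pos _), div_eq_mul_inv, ← Real.exp_neg, neg_mul, neg_neg]
  exact h1

/-- Jensen's inequality for a power and a density of total mass one. -/
lemma lintegral_mul_rpow_le {X : Type*} [MeasurableSpace X] {m : Measure X} {ρ g : X → ℝ≥0∞}
    (hρ : Measurable ρ) (hg : Measurable g) (hg1 : ∫⁻ x, g x ∂m = 1) {q : ℝ} (hq : 1 < q) :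
    (∫⁻ x, ρ x * g x ∂m) ^ q ≤ ∫⁻ x, ρ x ^ q * g x ∂m := by
  have hpq : q.HolderConjugate q.conjExponent := .conjExponent hq
  have h1 := ENNReal.lintegral_mul_le_Lp_mul_Lq (m.withDensity g) hpq
    (f := ρ) (g := fun _ => 1) hρ.aemeasurable aemeasurable_const
  have hmass : m.withDensity g Set.univ = 1 := by
    rw [withDensity_apply _ MeasurableSet.univ, setLIntegral_univ, hg1]
  simp only [Pi.mul_apply, mul_one, ENNReal.one_rpow, lintegral_const, hmass] at h1
  rw [lintegral_withDensity_eq_lintegral_mul _ hg hρ,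
    lintegral_withDensity_eq_lintegral_mul _ hg (hρ.pow_const _)] at h1
  simp only [Pi.mul_apply, mul_comm (g _)] at h1
  calc (∫⁻ x, ρ x * g x ∂m) ^ q ≤ ((∫⁻ x, ρ x ^ q * g x ∂m) ^ (1 / q)) ^ q :=
        ENNReal.rpow_le_rpow h1 hpq.nonneg
    _ = _ := by rw [← ENNReal.rpow_mul, one_div_mul_cancel hpq.ne_zero, ENNReal.rpow_one]

/-- The Volterra operator with affine symbol belongs to `S_p` for `p > 2`. -/
theorem RestrictedDoubling.memSchatten_of_enorm_sq_le
    (h : RestrictedDoubling (weightMeasure w) δ N C) (hw : AEMeasurable w) (hα : 0 < α)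
    {J : fockSpace α w →L[ℂ] fockSpace α w} {K : ℝ≥0∞} (hK : K ≠ ∞)
    (hJ : ∀ f : fockSpace α w, ‖J f‖ₑ ^ 2 ≤
      K * ∫⁻ z, ENNReal.ofReal ((1 + ‖z‖) ^ 2)⁻¹ * gaussSq α (entireRep f) z ∂weightMeasure w)
    {p : ℝ} (hp : 2 < p) : MemSchatten p J := by
  have := h.completeSpace_fockSpace hw hα
  obtain ⟨B, hB, hle⟩ := h.exists_sum_gaussSq_le hw hα
  have hq : 1 < p / 2 := by linarith
  have hq0 : 0 < p / 2 := by linarith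
  set I := ∫⁻ z, ENNReal.ofReal ((1 + ‖z‖) ^ (-p)) / weightMeasure w (Metric.closedBall z δ)
    ∂weightMeasure w with hI
  have hIt : I ≠ ∞ := (h.lintegral_one_add_norm_rpow_lt_top hp).ne
  have hMt : K ^ (p / 2) * (B * I) ≠ ∞ :=
    ENNReal.mul_ne_top (ENNReal.rpow_ne_top_of_nonneg hq0.le hK) (by finiteness)
  refine memSchatten_of_sum_norm_rpow_le (M := (K ^ (p / 2) * (B * I)).toReal) (by linarith)
    fun n e he => ?_
  have hg : ∀ i, Measurable (gaussSq α (entireRep (e i))) := fun i =>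
    measurable_gaussSq α (differentiable_entireRep (e i))
  have h1 : ∀ i, ‖J (e i)‖ₑ ^ p ≤ K ^ (p / 2) *
      ∫⁻ z, ENNReal.ofReal ((1 + ‖z‖) ^ (-p)) * gaussSq α (entireRep (e i)) z
        ∂weightMeasure w := by
    intro i
    -- A unit vector gives a probability density, to which Jensen's inequality with exponent p/2 > 1
    -- applies.
    have hmass : ∫⁻ z, gaussSq α (entireRep (e i)) z ∂weightMeasure w = 1 := by
      rw [← enorm_sq_eq_entireRep hw, ← ofReal_norm, he.1 i]
      simp
    calc ‖J (e i)‖ₑ ^ p = (‖J (e i)‖ₑ ^ 2) ^ (p / 2) := by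
          rw [← ENNReal.rpow_natCast, ← ENNReal.rpow_mul]
          congr 1
          push_cast
          ring
      _ ≤ (K * ∫⁻ z, ENNReal.ofReal ((1 + ‖z‖) ^ 2)⁻¹ * gaussSq α (entireRep (e i)) z
          ∂weightMeasure w) ^ (p / 2) := ENNReal.rpow_le_rpow (hJ _) hq0.le
      _ ≤ K ^ (p / 2) * ∫⁻ z, ENNReal.ofReal ((1 + ‖z‖) ^ 2)⁻¹ ^ (p / 2) *
          gaussSq α (entireRep (e i)) z ∂weightMeasure w := by
          rw [ENNReal.mul_rpow_of_nonneg _ _ hq0.le]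
          gcongr
          exact lintegral_mul_rpow_le (by fun_prop) (hg i) hmass hq
      _ = _ := by
          congr 1
          refine lintegral_congr fun z => ?_
          congr 1
          have hz : 0 < 1 + ‖z‖ := by positivity
          rw [ENNReal.ofReal_rpow_of_pos (by positivity), Real.inv_rpow (by positivity),
            Real.rpow_neg hz.le, ← Real.rpow_natCast, ← Real.rpow_mul hz.le]
          congr 3
          push_cast
          ring
  have h2 : ∑ i, ‖J (e i)‖ₑ ^ p ≤ K ^ (p / 2) * (B * I) :=
    calc ∑ i, ‖J (e i)‖ₑ ^ p
        ≤ ∑ i, K ^ (p / 2) * ∫⁻ z, ENNReal.ofReal ((1 + ‖z‖) ^ (-p)) *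
          gaussSq α (entireRep (e i)) z ∂weightMeasure w := Finset.sum_le_sum fun i _ => h1 i
      _ = K ^ (p / 2) * ∫⁻ z, ENNReal.ofReal ((1 + ‖z‖) ^ (-p)) *
          ∑ i, gaussSq α (entireRep (e i)) z ∂weightMeasure w := by
          rw [← Finset.mul_sum, ← lintegral_finsetSum _ fun i _ => by
            have := hg i
            fun_prop]
          simp only [Finset.mul_sum]
      _ ≤ K ^ (p / 2) * ∫⁻ z, B * (ENNReal.ofReal ((1 + ‖z‖) ^ (-p)) /
          weightMeasure w (Metric.closedBall z δ)) ∂weightMeasure w := by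
          refine mul_le_mul_right (lintegral_mono fun z => ?_) _
          calc _ ≤ ENNReal.ofReal ((1 + ‖z‖) ^ (-p)) *
                (B / weightMeasure w (Metric.closedBall z δ)) := by
                gcongr
                exact hle n e he z
            _ = _ := by
                simp only [div_eq_mul_inv]
                ring
      _ = _ := by rw [lintegral_const_mul' _ _ hB]
  rw [← ENNReal.ofReal_le_iff_le_toReal hMt, ENNReal.ofReal_sum_of_nonneg
    (fun i _ => by positivity)]
  refine le_trans (Finset.sum_le_sum fun i _ => ?_) h2
  rw [← ofReal_norm, ENNReal.ofReal_rpow_of_nonneg (norm_nonneg _) (by linarith)]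

end SchattenUpper

/-! ### Failure of the Hilbert–Schmidt property for a ≠ 0 -/

section NotHilbertSchmidt

/-- The test function is the kernel of the unweighted Fock space; under the Gaussian weight its
squared modulus is a bump centred at z. -/
lemma gaussSq_exp_eq (α : ℝ) (z ζ : ℂ) :
    gaussSq α (fun ζ => Complex.exp (α * (starRingEnd ℂ z * ζ))) ζ =
      ENNReal.ofReal (Real.exp (α * ‖z‖ ^ 2)) * ENNReal.ofReal (Real.exp (-α * ‖ζ - z‖ ^ 2)) := by
  have h1 := gaussSq_eq_exp_mul α (fun ζ => Complex.exp (α * (starRingEnd ℂ z * ζ))) z ζ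
  rw [← Complex.exp_add, neg_mul, add_neg_cancel, Complex.exp_zero, enorm_one, one_pow] at h1
  rw [← ENNReal.ofReal_mul (Real.exp_pos _).le, ← Real.exp_add]
  calc gaussSq α (fun ζ => Complex.exp (α * (starRingEnd ℂ z * ζ))) ζ
      = ENNReal.ofReal (Real.exp (α * ‖z‖ ^ 2 + -α * ‖ζ - z‖ ^ 2)) *
        ENNReal.ofReal (Real.exp (α * ‖ζ - z‖ ^ 2 - α * ‖z‖ ^ 2)) *
        gaussSq α (fun ζ => Complex.exp (α * (starRingEnd ℂ z * ζ))) ζ := by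
        rw [← ENNReal.ofReal_mul (Real.exp_pos _).le, ← Real.exp_add,
          show α * ‖z‖ ^ 2 + -α * ‖ζ - z‖ ^ 2 + (α * ‖ζ - z‖ ^ 2 - α * ‖z‖ ^ 2) = 0 by ring]
        simp
    _ = _ := by rw [mul_assoc, ← h1, mul_one]

lemma RestrictedDoubling.exists_lintegral_gaussian_le {m : Measure ℂ} [SFinite m] {δ : ℝ} {N : ℕ}
    {C : ℝ≥0∞} (h : RestrictedDoubling m δ N C) {α : ℝ} (hα : 0 < α) :
    ∃ D : ℝ≥0∞, D ≠ ∞ ∧ ∀ z, ∫⁻ ζ, ENNReal.ofReal (Real.exp (-α * ‖ζ - z‖ ^ 2)) ∂m ≤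
      D * m (Metric.closedBall z δ) := by
  obtain ⟨A, c, hA, hc, hW⟩ := h.exists_growth
  obtain ⟨M, hM, hexp⟩ := h.exists_lintegral_exp_div_le one_pos
  -- The maximum of -αd² + (c + 1)d: the Gaussian beats the growth rate c of W and still leaves
  -- e^{-d}.
  set κ := (c + 1) ^ 2 / (4 * α) with hκ
  refine ⟨ENNReal.ofReal (A * Real.exp κ) * M, by finiteness, fun z => ?_⟩
  have hpt : ∀ ζ, ENNReal.ofReal (Real.exp (-α * ‖ζ - z‖ ^ 2)) ≤
      ENNReal.ofReal (A * Real.exp κ) * m (Metric.closedBall z δ) *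
        (ENNReal.ofReal (Real.exp (-1 * ‖ζ - z‖)) / m (Metric.closedBall ζ δ)) := by
    intro ζ
    rw [← mul_div_assoc, ENNReal.le_div_iff_mul_le (.inl (h.ne_zero ζ)) (.inl (h.ne_top ζ))]
    calc ENNReal.ofReal (Real.exp (-α * ‖ζ - z‖ ^ 2)) * m (Metric.closedBall ζ δ)
        ≤ ENNReal.ofReal (Real.exp (-α * ‖ζ - z‖ ^ 2)) *
          (ENNReal.ofReal (A * Real.exp (c * dist z ζ)) * m (Metric.closedBall z δ)) := by
          gcongr
          exact hW z ζ
      _ = ENNReal.ofReal (A * Real.exp (-α * ‖ζ - z‖ ^ 2 + c * ‖ζ - z‖)) *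
          m (Metric.closedBall z δ) := by
          rw [← mul_assoc, ← ENNReal.ofReal_mul (Real.exp_pos _).le, dist_comm, dist_eq_norm,
            Real.exp_add]
          congr 2
          ring
      _ ≤ ENNReal.ofReal (A * Real.exp (κ + -1 * ‖ζ - z‖)) * m (Metric.closedBall z δ) := by
          gcongr ENNReal.ofReal (A * Real.exp ?_) * _
          set d := ‖ζ - z‖
          have h1 : 0 ≤ (2 * α * d - (c + 1)) ^ 2 / (4 * α) := by positivity
          have h2 : (2 * α * d - (c + 1)) ^ 2 / (4 * α) = α * d ^ 2 - (c + 1) * d + κ := by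
            rw [hκ]
            field_simp
            ring
          nlinarith
      _ = _ := by
          rw [Real.exp_add, ← mul_assoc, ENNReal.ofReal_mul (by positivity)]
          ring
  calc ∫⁻ ζ, ENNReal.ofReal (Real.exp (-α * ‖ζ - z‖ ^ 2)) ∂m
      ≤ ∫⁻ ζ, ENNReal.ofReal (A * Real.exp κ) * m (Metric.closedBall z δ) *
        (ENNReal.ofReal (Real.exp (-1 * ‖ζ - z‖)) / m (Metric.closedBall ζ δ)) ∂m :=
        lintegral_mono hpt
    _ ≤ ENNReal.ofReal (A * Real.exp κ) * m (Metric.closedBall z δ) * M := by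
        rw [lintegral_const_mul' _ _ (by have := h.ne_top z; finiteness)]
        gcongr
        exact hexp z
    _ = _ := by ring

/-- On the segment ζ = tz the exponent αt‖z‖² is real, so there is no cancellation and the integral
is explicit. -/
lemma norm_volterra_affine_exp (a b : ℂ) {α : ℝ} (hα : 0 < α) {z : ℂ} (hz : z ≠ 0) :
    ‖volterra (fun z => a * z + b) (fun ζ => Complex.exp (α * (starRingEnd ℂ z * ζ))) z‖ =
      ‖a‖ * (Real.exp (α * ‖z‖ ^ 2) - 1) / (α * ‖z‖) := by
  have hz' : 0 < ‖z‖ := norm_pos_iff.2 hz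
  set x := α * ‖z‖ ^ 2 with hx
  have hx0 : 0 < x := by positivity
  have h1 : ∀ t : ℝ, Complex.exp (α * (starRingEnd ℂ z * (t * z))) * a * z =
      ((Real.exp (x * t) : ℝ) : ℂ) * (a * z) := fun t => by
    have h2 : (α : ℂ) * (starRingEnd ℂ z * (t * z)) = ((x * t : ℝ) : ℂ) := by
      rw [hx]
      push_cast
      rw [← Complex.conj_mul']
      ring
    rw [h2, Complex.ofReal_exp]
    ring
  have h3 : ∫ t in (0 : ℝ)..1, Real.exp (x * t) = (Real.exp x - 1) / x := by
    have := intervalIntegral.integral_comp_mul_left (a := 0) (b := 1) Real.exp hx0.ne'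
    rw [this, integral_exp, mul_zero, mul_one, Real.exp_zero, smul_eq_mul, inv_mul_eq_div]
  rw [volterra_affine]
  simp only [h1]
  rw [intervalIntegral.integral_mul_const, intervalIntegral.integral_ofReal, h3, norm_mul,
    Complex.norm_real, norm_mul, Real.norm_of_nonneg]
  · rw [hx]
    field_simp
  · have := Real.one_le_exp hx0.le
    exact div_nonneg (by linarith) hx0.le

/-- A lower bound for the Volterra operator on the test functions `exp (α z̄ ζ)`. -/
lemma exists_le_gaussSq_volterra_exp {a : ℂ} (ha : a ≠ 0) (b : ℂ) {α : ℝ} (hα : 0 < α) :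
    ∃ c : ℝ, 0 < c ∧ ∀ z : ℂ,
      c * (Set.Ici 1).indicator (fun x => (x ^ 2)⁻¹) ‖z‖ * Real.exp (2 * (α * ‖z‖ ^ 2)) ≤
        ‖volterra (fun z => a * z + b)
          (fun ζ => Complex.exp (α * (starRingEnd ℂ z * ζ))) z‖ ^ 2 := by
  have ha' : 0 < ‖a‖ := norm_pos_iff.2 ha
  have hε : 0 < 1 - Real.exp (-α) := by
    rw [sub_pos, Real.exp_lt_one_iff]
    linarith
  -- For ‖z‖ ≥ 1 one has e^x - 1 ≥ (1 - e^{-α}) e^x with x = α‖z‖².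
  refine ⟨(‖a‖ * (1 - Real.exp (-α)) / α) ^ 2, by positivity, fun z => ?_⟩
  by_cases hz : 1 ≤ ‖z‖
  · rw [Set.indicator_of_mem (by exact hz), norm_volterra_affine_exp a b hα
      (norm_pos_iff.1 (by linarith))]
    have h1 : Real.exp (α * ‖z‖ ^ 2) * (1 - Real.exp (-α)) ≤ Real.exp (α * ‖z‖ ^ 2) - 1 := by
      have h2 : 1 ≤ Real.exp (α * ‖z‖ ^ 2) * Real.exp (-α) := by
        rw [← Real.exp_add, Real.one_le_exp_iff]
        nlinarith [mul_le_mul_of_nonneg_left (one_le_pow₀ hz (n := 2)) hα.le]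
      linarith
    have h4 : Real.exp (2 * (α * ‖z‖ ^ 2)) = Real.exp (α * ‖z‖ ^ 2) ^ 2 := by
      rw [← Real.exp_nat_mul]
      norm_num
    have hz0 : 0 < ‖z‖ := by linarith
    calc (‖a‖ * (1 - Real.exp (-α)) / α) ^ 2 * (‖z‖ ^ 2)⁻¹ * Real.exp (2 * (α * ‖z‖ ^ 2))
        = (‖a‖ * (Real.exp (α * ‖z‖ ^ 2) * (1 - Real.exp (-α))) / (α * ‖z‖)) ^ 2 := by
          rw [h4]
          field_simp
      _ ≤ _ := by gcongr
  · rw [Set.indicator_of_notMem (by exact hz)]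
    simp only [mul_zero, zero_mul]
    positivity

variable {α : ℝ} {w : ℂ → ℝ} {δ : ℝ} {N : ℕ} {C : ℝ≥0∞}

/-- Pointwise bound for an operator on the Fock space in terms of a Schatten decomposition. -/
lemma RestrictedDoubling.enorm_entireRep_sq_le_of_hasSum
    (h : RestrictedDoubling (weightMeasure w) δ N C) (hw : AEMeasurable w) (hα : 0 < α)
    {s : ℕ → ℝ} {e σ : ℕ → fockSpace α w}
    (he : Orthonormal ℂ (fun n : {n : ℕ // s n ≠ 0} => e n)) {x y : fockSpace α w}
    (hsum : HasSum (fun n => ((s n : ℂ) * inner ℂ (e n) x) • σ n) y) (z : ℂ) :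
    ‖entireRep y z‖ₑ ^ 2 ≤
      ‖x‖ₑ ^ 2 * ∑' n, ENNReal.ofReal (s n ^ 2) * ‖entireRep (σ n) z‖ₑ ^ 2 := by
  obtain ⟨κ, -, hκ⟩ := h.exists_norm_entireRep_le hw hα
  set ev := (h.evalₗ hw hα z).mkContinuous (κ z) fun f => hκ f z with hev
  have hev' : ∀ f, ev f = entireRep f z := fun _ => rfl
  have hmap := hsum.mapL ev
  have hfin : ∀ F : Finset ℕ,
      ‖∑ n ∈ F, (s n : ℂ) * inner ℂ (e n) x * entireRep (σ n) z‖ₑ ^ 2 ≤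
      ‖x‖ₑ ^ 2 * ∑' n, ENNReal.ofReal (s n ^ 2) * ‖entireRep (σ n) z‖ₑ ^ 2 := by
    intro F
    -- Orthonormality of `e` is available only where `s n ≠ 0`; the other terms vanish.
    set F' := F.filter fun n => s n ≠ 0 with hF'
    have hbessel : ∑ n ∈ F', ‖inner ℂ (e n) x‖ ^ 2 ≤ ‖x‖ ^ 2 := by
      have h1 := he.sum_inner_products_le x (s := F.subtype fun n => s n ≠ 0)
      rwa [Finset.sum_subtype_eq_sum_filter (f := fun n => ‖inner ℂ (e n) x‖ ^ 2)] at h1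
    have h2 : ‖∑ n ∈ F, (s n : ℂ) * inner ℂ (e n) x * entireRep (σ n) z‖ ^ 2 ≤
        ‖x‖ ^ 2 * ∑ n ∈ F', s n ^ 2 * ‖entireRep (σ n) z‖ ^ 2 := by
      have h3 : ∑ n ∈ F, (s n : ℂ) * inner ℂ (e n) x * entireRep (σ n) z =
          ∑ n ∈ F', (s n : ℂ) * inner ℂ (e n) x * entireRep (σ n) z := by
        rw [hF', Finset.sum_filter_of_ne]
        intro n _ hn h0
        simp [h0] at hn
      rw [h3]
      calc ‖∑ n ∈ F', (s n : ℂ) * inner ℂ (e n) x * entireRep (σ n) z‖ ^ 2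
          ≤ (∑ n ∈ F', ‖inner ℂ (e n) x‖ * (|s n| * ‖entireRep (σ n) z‖)) ^ 2 := by
            gcongr
            refine (norm_sum_le _ _).trans (le_of_eq (Finset.sum_congr rfl fun n _ => ?_))
            rw [norm_mul, norm_mul, Complex.norm_real, Real.norm_eq_abs]
            ring
        _ ≤ (∑ n ∈ F', ‖inner ℂ (e n) x‖ ^ 2) *
            ∑ n ∈ F', (|s n| * ‖entireRep (σ n) z‖) ^ 2 := Finset.sum_mul_sq_le_sq_mul_sq _ _ _
        _ ≤ ‖x‖ ^ 2 * ∑ n ∈ F', (|s n| * ‖entireRep (σ n) z‖) ^ 2 := by gcongr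
        _ = _ := by simp only [mul_pow, sq_abs]
    calc ‖∑ n ∈ F, (s n : ℂ) * inner ℂ (e n) x * entireRep (σ n) z‖ₑ ^ 2
        = ENNReal.ofReal (‖∑ n ∈ F, (s n : ℂ) * inner ℂ (e n) x * entireRep (σ n) z‖ ^ 2) := by
          rw [ENNReal.ofReal_pow (norm_nonneg _), ofReal_norm]
      _ ≤ ENNReal.ofReal (‖x‖ ^ 2 * ∑ n ∈ F', s n ^ 2 * ‖entireRep (σ n) z‖ ^ 2) :=
          ENNReal.ofReal_le_ofReal h2
      _ = ‖x‖ₑ ^ 2 * ∑ n ∈ F', ENNReal.ofReal (s n ^ 2) * ‖entireRep (σ n) z‖ₑ ^ 2 := by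
          rw [ENNReal.ofReal_mul (by positivity), ENNReal.ofReal_pow (norm_nonneg _), ofReal_norm,
            ENNReal.ofReal_sum_of_nonneg (fun _ _ => by positivity)]
          congr 1
          refine Finset.sum_congr rfl fun n _ => ?_
          rw [ENNReal.ofReal_mul (by positivity), ENNReal.ofReal_pow (norm_nonneg _), ofReal_norm]
      _ ≤ _ := by
          gcongr
          exact ENNReal.sum_le_tsum F'
  have hlim : Tendsto (fun F : Finset ℕ =>
      ‖∑ n ∈ F, (s n : ℂ) * inner ℂ (e n) x * entireRep (σ n) z‖ₑ ^ 2) atTop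
      (𝓝 (‖entireRep y z‖ₑ ^ 2)) := by
    have h4 : Tendsto (fun F : Finset ℕ =>
        ∑ n ∈ F, (s n : ℂ) * inner ℂ (e n) x * entireRep (σ n) z) atTop (𝓝 (entireRep y z)) := by
      simp only [map_smul, smul_eq_mul] at hmap
      simp only [hev'] at hmap
      exact hmap
    exact ((ENNReal.continuous_pow 2).tendsto _).comp h4.enorm
  exact le_of_tendsto' hlim hfin

/-- The Volterra operator with a non-constant affine symbol is not Hilbert–Schmidt. -/
theorem RestrictedDoubling.not_isHilbertSchmidt
    (h : RestrictedDoubling (weightMeasure w) δ N C) (hw : AEMeasurable w) (hα : 0 < α)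
    {a b : ℂ} (ha : a ≠ 0) {J : fockSpace α w →L[ℂ] fockSpace α w}
    (hJ : IsVolterraOperator (fun z => a * z + b) J) : ¬ IsHilbertSchmidt J := by
  rintro ⟨s, e, σ, -, -, -, he, hσ, hsum, hs⟩
  obtain ⟨D, hD, hgauss⟩ := h.exists_lintegral_gaussian_le hα
  obtain ⟨c, hc, hlow⟩ := exists_le_gaussSq_volterra_exp ha b hα
  set m := weightMeasure w with hm
  set ψ : ℂ → ℝ := fun z => (Set.Ici 1).indicator (fun x : ℝ => (x ^ 2)⁻¹) ‖z‖ with hψ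
  have hψ0 : ∀ z, 0 ≤ ψ z := fun z => Set.indicator_nonneg (fun x _ => by positivity) _
  have hpt : ∀ z, ENNReal.ofReal c * (ENNReal.ofReal (ψ z) / m (Metric.closedBall z δ)) ≤
      D * ∑' n, ENNReal.ofReal (s n ^ 2) * gaussSq α (entireRep (σ n)) z := by
    intro z
    set F : ℂ → ℂ := fun ζ => Complex.exp (α * (starRingEnd ℂ z * ζ)) with hF
    have hFd : Differentiable ℂ F := by fun_prop
    set E := ENNReal.ofReal (Real.exp (α * ‖z‖ ^ 2)) with hE
    have hFn : ∫⁻ ζ, gaussSq α F ζ ∂m ≤ E * (D * m (Metric.closedBall z δ)) := by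
      simp only [hF, gaussSq_exp_eq]
      rw [lintegral_const_mul' _ _ ENNReal.ofReal_ne_top]
      gcongr
      exact hgauss z
    have hmt := h.ne_top z
    have hFt : ∫⁻ ζ, gaussSq α F ζ ∂m ≠ ∞ := ne_top_of_le_ne_top (by finiteness) hFn
    set f := ofEntire hw hFd hFt with hf
    have hfn : ‖f‖ₑ ^ 2 = ∫⁻ ζ, gaussSq α F ζ ∂m :=
      enorm_sq_eq_lintegral_gaussSq hw hFd (coeFn_ofEntire hw hFd hFt)
    have hJf : entireRep (J f) = volterra (fun z => a * z + b) F :=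
      h.entireRep_eq hw hα (differentiable_volterra_affine a b hFd)
        (hJ f F hFd (coeFn_ofEntire hw hFd hFt))
    have h1 := h.enorm_entireRep_sq_le_of_hasSum hw hα he (hsum f) z
    set S := ∑' n, ENNReal.ofReal (s n ^ 2) * ‖entireRep (σ n) z‖ₑ ^ 2 with hS
    -- The operator contributes E² on the left and the norm of the test function only E on the
    -- right; the remaining 1/E is the Gaussian weight of the σ_n.
    have h2 : ENNReal.ofReal c * ENNReal.ofReal (ψ z) * (E * E) ≤
        E * (D * m (Metric.closedBall z δ)) * S := by
      calc ENNReal.ofReal c * ENNReal.ofReal (ψ z) * (E * E)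
          = ENNReal.ofReal (c * ψ z * Real.exp (2 * (α * ‖z‖ ^ 2))) := by
            have := hψ0 z
            rw [ENNReal.ofReal_mul (by positivity), ENNReal.ofReal_mul hc.le, two_mul,
              Real.exp_add, ENNReal.ofReal_mul (Real.exp_pos _).le]
        _ ≤ ENNReal.ofReal (‖entireRep (J f) z‖ ^ 2) := by
            rw [hJf]
            exact ENNReal.ofReal_le_ofReal (hlow z)
        _ = ‖entireRep (J f) z‖ₑ ^ 2 := by
            rw [ENNReal.ofReal_pow (norm_nonneg _), ofReal_norm]
        _ ≤ ‖f‖ₑ ^ 2 * S := h1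
        _ ≤ _ := by
            rw [hfn]
            gcongr
    have hgS : ∑' n, ENNReal.ofReal (s n ^ 2) * gaussSq α (entireRep (σ n)) z =
        ENNReal.ofReal (Real.exp (-α * ‖z‖ ^ 2)) * S := by
      rw [hS, ← ENNReal.tsum_mul_left]
      refine tsum_congr fun n => ?_
      rw [gaussSq]
      ring
    have hEinv : ENNReal.ofReal (Real.exp (-α * ‖z‖ ^ 2)) = E⁻¹ := by
      rw [hE, ← ENNReal.ofReal_inv_of_pos (Real.exp_pos _), ← Real.exp_neg, neg_mul]
    have hE0 : E ≠ 0 := by simp [hE, Real.exp_pos]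
    have hEt : E ≠ ∞ := ENNReal.ofReal_ne_top
    rw [hgS, hEinv, ← mul_div_assoc, ENNReal.div_le_iff (h.ne_zero z) (h.ne_top z),
      ← ENNReal.mul_le_mul_iff_left (mul_ne_zero hE0 hE0) (ENNReal.mul_ne_top hEt hEt)]
    refine h2.trans (le_of_eq ?_)
    calc E * (D * m (Metric.closedBall z δ)) * S
        = (E⁻¹ * E) * (E * (D * m (Metric.closedBall z δ)) * S) := by
          rw [ENNReal.inv_mul_cancel hE0 hEt, one_mul]
      _ = _ := by ring
  have hle := lintegral_mono (μ := m) hpt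
  rw [lintegral_const_mul' _ _ ENNReal.ofReal_ne_top, h.lintegral_norm_inv_sq_div_eq_top,
    ENNReal.mul_top (by simpa using hc), lintegral_const_mul' _ _ hD,
    lintegral_tsum fun n => ((measurable_gaussSq α
      (differentiable_entireRep (σ n))).const_mul _).aemeasurable, top_le_iff] at hle
  -- The left side is infinite, while the right side is at most D ∑ s_n², because ‖σ_n‖ = 1 whenever
  -- s_n ≠ 0.
  refine absurd hle (ENNReal.mul_ne_top hD (ne_top_of_le_ne_top hs.tsum_ofReal_ne_top
    (ENNReal.tsum_le_tsum fun n => ?_)))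
  rw [lintegral_const_mul' _ _ ENNReal.ofReal_ne_top, ← enorm_sq_eq_entireRep hw]
  by_cases hn : s n = 0
  · simp [hn]
  · have h5 : ‖σ n‖ₑ = 1 := by
      rw [← ofReal_norm, hσ.1 ⟨n, hn⟩, ENNReal.ofReal_one]
    rw [h5, one_pow, mul_one]
    exact_mod_cast le_rfl

end NotHilbertSchmidt

/-! ### The case a = 0 and conclusion -/

lemma memSchatten_zero {H : Type*} [NormedAddCommGroup H] [InnerProductSpace ℂ H] {p : ℝ}
    (hp : 0 < p) : MemSchatten p (0 : H →L[ℂ] H) :=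
  ⟨0, 0, 0, antitone_const, fun _ => le_rfl, tendsto_const_nhds,
    ⟨fun n => absurd rfl n.2, fun n => absurd rfl n.2⟩,
    ⟨fun n => absurd rfl n.2, fun n => absurd rfl n.2⟩,
    fun _ => by simp, by simp [Real.zero_rpow hp.ne']⟩

lemma IsVolterraOperator.eq_zero {α : ℝ} {w : ℂ → ℝ} {b : ℂ}
    {J : fockSpace α w →L[ℂ] fockSpace α w} (hJ : IsVolterraOperator (fun z => 0 * z + b) J) :
    J = 0 := by
  ext1 f
  refine Subtype.ext (Lp.ext ?_)
  refine (hJ f _ (differentiable_entireRep f) (ae_eq_entireRep f)).trans ?_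
  have : volterra (fun z => 0 * z + b) (entireRep f) = 0 := by
    ext z
    rw [volterra_affine]
    simp
  rw [this]
  exact (Lp.coeFn_zero _ _ _).symm

end WeightedFock

theorem corollary6p1 (α : ℝ) (hα : 0 < α) (w : ℂ → ℝ) (hw : WeightedFock.IsWeight w)
    (hwA : WeightedFock.IsRestrictedAInfty w) (a b : ℂ) :
    ∃ J : WeightedFock.fockSpace α w →L[ℂ] WeightedFock.fockSpace α w,
      WeightedFock.IsVolterraOperator (fun z => a * z + b) J ∧
      (∀ p : ℝ, 2 < p → WeightedFock.MemSchatten p J) ∧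
      (WeightedFock.IsHilbertSchmidt J ↔ a = 0) := by
  obtain ⟨δ, N, C, h⟩ := hwA.exists_restrictedDoubling hw
  have hwm : AEMeasurable w := hw.locallyIntegrable.aestronglyMeasurable.aemeasurable
  obtain ⟨J, hJ, K, hK, hle⟩ := h.exists_volterraOperator hwm hα a b
  refine ⟨J, hJ, fun p hp => h.memSchatten_of_enorm_sq_le hwm hα hK hle hp, fun hHS => ?_, ?_⟩
  · by_contra ha
    exact h.not_isHilbertSchmidt hwm hα ha hJ hHS
  · rintro rfl
    rw [hJ.eq_zero]
    exact WeightedFock.memSchatten_zero two_pos
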